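/- Consider open, non-preemptive online \textsc{Dial-a-Ride} on the real line. A finite sequence $\sigma$ of requests $(a_i,b_i;r_i)$ with $a_i,b_i\in\mathbb{R}$ and $r_i\ge 0$ is given; request $i$ appears at time $r_i$ in position $a_i$ and must be transported to $b_i$. A single server starts at the origin at time $0$, moves with at most unit speed, carries at most $c\in\{1,2,\dots\}\cup\{\infty\}$ requests at a time, may collect request $i$ at $a_i$ only from time $r_i$ on and only while it carries fewer than $c$ requests, and may unload it only at $b_i$. It need not return to the origin. For a set $R$ of requests, let $L(t,p,R)$ be the smallest length (completion time minus $t$) of a schedule that starts at position $p$ at time $t$ with an empty server and serves all requests in $R$, respecting release times, and let $\mathrm{Opt}(\sigma)=L(0,0,\sigma)$ be the optimal offline completion time. The algorithm $\textsc{SmarterStart}_\Theta$ with parameter $\Theta>1$ works as follows. If at time $t$ it has finished a schedule (or has not started any yet), it waits for the first time $s\ge t$ at which there is at least one released unserved request and $s\ge L(s,0,\sigma_{\le s})/(\Theta-1)$, where $\sigma_{\le s}$ is the set of requests released until time $s$. At time $s$ it starts to execute, from its current position, an optimal offline schedule for the requests that are released but not yet served at time $s$ (chosen arbitrarily if there are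 several), ignoring new requests until the schedule is finished. Then it repeats. The competitive ratio of an algorithm with completion times $\mathrm{Alg}(\sigma)$ is the infimum of all real $\rho$ with $\mathrm{Alg}(\sigma)\le\rho\,\mathrm{Opt}(\sigma)$ for all $\sigma$ (it is $+\infty$ if there is no such $\rho$). Let $f_1(\Theta)=\frac{2\Theta^2-\Theta+1}{\Theta^2-1}$ and $f_2(\Theta)=\frac{3\Theta^2+3}{2\Theta+1}$. The equation $f_1(\Theta)=f_2(\Theta)$ has a largest real solution $\Theta^*$. With $\rho^*:=f_1(\Theta^*)=f_2(\Theta^*)$ we have $|\Theta^*-1.7125|<5\cdot 10^{-5}$ and $|\rho^*-2.6662|<5\cdot 10^{-5}$. For every capacity $c$ the following holds. (i) For every $\Theta>1$, $\textsc{SmarterStart}_\Theta$ can be executed on every request sequence and serves all its requests. (ii) The competitive ratio of $\textsc{SmarterStart}_{\Theta^*}$ is exactly $\rho^*$, and it is attained, i.e. $\textsc{SmarterStart}_{\Theta^*}(\sigma)\le\rho^*\,\mathrm{Opt}(\sigma)$ for all $\sigma$. (iii) For every $\Theta>1$ with $\Theta\ne\Theta^*$, the competitive ratio of $\textsc{SmarterStart}_\Theta$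 is strictly larger than $\rho^*$. Both (ii) and (iii) hold for every way of choosing among several optimal schedules. -/

import Mathlib

/-- A transportation request `(a, b; r)`: it appears at time `r ≥ 0` at position `a` of the real
line and has to be transported to position `b`. -/
structure Request where
  source : ℝ
  target : ℝ
  release : ℝ
  release_nonneg : 0 ≤ release

/-- A finite sequence of requests (repetitions are allowed). -/
structure RequestSeq where
  n : ℕ
  req : Fin n → Request

/-- Feasible schedules of a single server of capacity `c`, non-preemptive and open.

`Serves c σ W K p t q T` says: a server that is at position `p` at time `t`, that carries exactly
the requests in `K`, and that still has to collect exactly the requests in `W`, can collect and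
deliver all of them so that the last delivery takes place at time `T` in position `q`.

A schedule is a sequence of events, each one the collection or the delivery of a request.
Between consecutive events the server moves with at most unit speed (it may wait), so that an
event at position `x` and time `t'` can follow an event at position `p` and time `t` exactly
if `t + |x - p| ≤ t'`. A request is collected at its source, not before its release, and only
if fewer than `c` requests are being carried; it is then carried until it is delivered at its
target. -/
inductive Serves (c : ℕ∞) (σ : RequestSeq) :
    Finset (Fin σ.n) → Finset (Fin σ.n) → ℝ → ℝ → ℝ → ℝ → Prop
  | done (p t : ℝ) : Serves c σ ∅ ∅ p t p t
  | collect {W K : Finset (Fin σ.n)} {p t q T : ℝ} (i : Fin σ.n) (t' : ℝ)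
      (mem : i ∈ W) (capacity : (K.card : ℕ∞) < c)
      (move : t + |(σ.req i).source - p| ≤ t') (released : (σ.req i).release ≤ t')
      (rest : Serves c σ (W.erase i) (insert i K) (σ.req i).source t' q T) :
      Serves c σ W K p t q T
  | deliver {W K : Finset (Fin σ.n)} {p t q T : ℝ} (i : Fin σ.n) (t' : ℝ)
      (mem : i ∈ K)
      (move : t + |(σ.req i).target - p| ≤ t')
      (rest : Serves c σ W (K.erase i) (σ.req i).target t' q T) :
      Serves c σ W K p t q T

/-- `L(t, p, R)`: the smallest length (completion time minus `t`) of a schedule that starts at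
position `p` at time `t` with an empty server and serves all requests in `R`, respecting the
release times. -/
noncomputable def minLength (c : ℕ∞) (σ : RequestSeq) (t p : ℝ) (R : Finset (Fin σ.n)) : ℝ :=
  sInf {l : ℝ | ∃ q : ℝ, Serves c σ R ∅ p t q (t + l)}

/-- The optimal offline completion time: the server starts at the origin at time `0`. -/
noncomputable def opt (c : ℕ∞) (σ : RequestSeq) : ℝ :=
  minLength c σ 0 0 Finset.univ

/-- The requests that have been released until time `t`. -/
noncomputable def releasedUntil (σ : RequestSeq) (t : ℝ) : Finset (Fin σ.n) :=
  Finset.univ.filter (fun i => (σ.req i).release ≤ t)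

/-- The executions of SmarterStart with parameter `Θ`.

`SmarterStartFrom c Θ σ D p t T` says: if at time `t` the server is empty at position `p`, has just
finished a schedule (or is at the very beginning), and has served exactly the requests in `D` so
far, then some execution of SmarterStart from this situation serves the last request at time `T`.

The next schedule is started at the first time `s ≥ t` at which there are released unserved
requests and `L(s, 0, {requests released until s}) / (Θ - 1) ≤ s`. It is any optimal offline
schedule that starts in the current position at time `s` and serves the requests that are released
but not yet served at time `s`. It is executed without taking notice of new requests. -/
inductive SmarterStartFrom (c : ℕ∞) (Θ : ℝ) (σ : RequestSeq) :
    Finset (Fin σ.n) → ℝ → ℝ → ℝ → Prop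
  | finished (p t : ℝ) : SmarterStartFrom c Θ σ Finset.univ p t t
  | schedule {D : Finset (Fin σ.n)} {p t T : ℝ} (s q : ℝ)
      (start : IsLeast {s' : ℝ | t ≤ s' ∧ (releasedUntil σ s' \ D).Nonempty ∧
        minLength c σ s' 0 (releasedUntil σ s') / (Θ - 1) ≤ s'} s)
      (optimal : Serves c σ (releasedUntil σ s \ D) ∅ p s q
        (s + minLength c σ s p (releasedUntil σ s \ D)))
      (rest : SmarterStartFrom c Θ σ (D ∪ releasedUntil σ s) q
        (s + minLength c σ s p (releasedUntil σ s \ D)) T) :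
      SmarterStartFrom c Θ σ D p t T

/-- `T` is the completion time of an execution of SmarterStart with parameter `Θ` on `σ`. -/
def IsCompletionTime (c : ℕ∞) (Θ : ℝ) (σ : RequestSeq) (T : ℝ) : Prop :=
  SmarterStartFrom c Θ σ ∅ 0 0 T

/-- `A` gives the completion times of SmarterStart with parameter `Θ`, for some way of choosing
among several optimal schedules. -/
def IsSmarterStart (c : ℕ∞) (Θ : ℝ) (A : RequestSeq → ℝ) : Prop :=
  ∀ σ : RequestSeq, IsCompletionTime c Θ σ (A σ)

/-- An algorithm with completion times `A` is `ρ`-competitive. -/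
def IsCompetitive (c : ℕ∞) (A : RequestSeq → ℝ) (ρ : ℝ) : Prop :=
  ∀ σ : RequestSeq, A σ ≤ ρ * opt c σ

/-- The competitive ratio of an algorithm with completion times `A` (`⊤` if there is none). -/
noncomputable def competitiveRatio (c : ℕ∞) (A : RequestSeq → ℝ) : EReal :=
  sInf {x : EReal | ∃ ρ : ℝ, IsCompetitive c A ρ ∧ x = (ρ : EReal)}

/-- The function `f₁(Θ) = (2Θ² - Θ + 1) / (Θ² - 1)`. -/
noncomputable def fWait (Θ : ℝ) : ℝ := (2 * Θ ^ 2 - Θ + 1) / (Θ ^ 2 - 1)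

/-- The function `f₂(Θ) = (3Θ² + 3) / (2Θ + 1)`. -/
noncomputable def fNoWait (Θ : ℝ) : ℝ := (3 * Θ ^ 2 + 3) / (2 * Θ + 1)

/-!
The set of completion times of a schedule is dominated by a finite set, so optimal schedules exist,
and the starting condition of SmarterStart depends on the time only through the set of released
requests, so there is always a first time at which it holds. Hence every execution can be continued.

**Upper bound.** Let `o` be the optimal cost, and compare a schedule `S` of SmarterStart, started at
time `s` in position `p` with length `Y`, with an optimal schedule which collects its first request
of `S` in position `a` at time `τ`. Going to `a` and then following the optimal schedule shows
`Y ≤ |p - a| + o - τ`; here `τ ≥ u` if the previous schedule was started at time `u`, and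
`|p| ≤ (Θ - 1) * u` by the waiting condition. If SmarterStart waited before `S`, then `s` is at most
`o / (Θ - 1)`, and this gives `s + Y ≤ fWait Θ * o` (`wait_bound`). If it did not wait, then
`s = u + X`, where `X` is the length of the previous schedule, started in `p₀`. Two estimates are
combined in `no_wait_bound`. The optimal schedule has to visit `p`, after the start `v` of the
schedule before the previous one; if `max v |p|` is large, this leaves little time for the
distance `|p - a|`. Otherwise `p₀` and `p` are near the origin, and `X` is estimated
by following the optimal schedule up to its last delivery `e` of a request of the previous schedule:
that schedule visits `e` and ends in `p`, hence `2 * |p - e| ≤ X + |p₀| + |p|`, and `e` is a short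
way in time from `a`. The result is `fNoWait Θ * o`. As `Θopt` balances the two bounds, it is
`ρopt`-competitive.

**Lower bounds.** With `y = 1 / (Θ - 1)`, three families of sequences are used. A transport
from `-y` to `1`, released when the server has just left for the position `1`, gives the ratio
`fWait Θ` for every `Θ` (`le_of_transport`). Requests in `-y` and close to `2 + y` make the server
end in `-y` while the optimal server goes to the right; this gives `fNoWait Θ` for `Θ ≤ 2` and more
than `2.667` for `2 < Θ ≤ 8 / 3` (`le_of_zigzag`). For larger `Θ` the server hardly waits, and it
is sent back to the origin twice (`le_of_two_returns`). Since `fWait` decreases on `(1, 2]` and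
`fNoWait` increases, every `Θ ≠ Θopt` has a ratio above `ρopt`.
-/

/-! ### Schedules -/

section Schedules

variable {c : ℕ∞} {σ : RequestSeq} {W K : Finset (Fin σ.n)} {p t q T : ℝ}

theorem Serves.start_le (h : Serves c σ W K p t q T) : t ≤ T := by
  induction h with
  | done p t => exact le_rfl
  | collect i t' mem cap move rel rest ih =>
    exact ((le_add_of_nonneg_right (abs_nonneg _)).trans move).trans ih
  | deliver i t' mem move rest ih =>
    exact ((le_add_of_nonneg_right (abs_nonneg _)).trans move).trans ih

/-- A schedule may be moved in time if everything it has to collect is released at its new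
start. -/
theorem Serves.translate (h : Serves c σ W K p t q T) (d : ℝ)
    (hd : ∀ i ∈ W, (σ.req i).release ≤ t + d) : Serves c σ W K p (t + d) q (T + d) := by
  induction h with
  | done p t => exact .done p _
  | @collect W K p t q T i t' mem cap move rel rest ih =>
    have ht : t ≤ t' := le_trans (by linarith [abs_nonneg ((σ.req i).source - p)]) move
    refine .collect i (t' + d) mem cap (by linarith) (by linarith [hd i mem]) (ih ?_)
    intro j hj
    linarith [hd j (Finset.mem_of_mem_erase hj)]
  | @deliver W K p t q T i t' mem move rest ih =>
    have ht : t ≤ t' := le_trans (by linarith [abs_nonneg ((σ.req i).target - p)]) move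
    refine .deliver i (t' + d) mem (by linarith) (ih ?_)
    intro j hj
    linarith [hd j hj]

/-- The server may first travel to the start of a schedule. Without any event there would be
nothing to travel for, and the schedule would end at once. -/
theorem Serves.prepend {x t₀ : ℝ} (h : Serves c σ W K x t q T) (hne : (W ∪ K).Nonempty)
    (hm : t₀ + |x - p| ≤ t) : Serves c σ W K p t₀ q T := by
  cases h with
  | done => simp at hne
  | collect i t' mem cap move rel rest =>
    refine .collect i t' mem cap ?_ rel rest
    linarith [abs_sub_le (σ.req i).source x p]
  | deliver i t' mem move rest =>
    refine .deliver i t' mem ?_ rest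
    linarith [abs_sub_le (σ.req i).target x p]

theorem Serves.exists_le_of_le {t₀ : ℝ} (h : Serves c σ W K p t q T) (ht : t₀ ≤ t) :
    ∃ T₀ ≤ T, Serves c σ W K p t₀ q T₀ := by
  cases h with
  | done => exact ⟨t₀, ht, .done p t₀⟩
  | collect i t' mem cap move rel rest =>
    exact ⟨T, le_rfl, .collect i t' mem cap (by linarith) rel rest⟩
  | deliver i t' mem move rest =>
    exact ⟨T, le_rfl, .deliver i t' mem (by linarith) rest⟩

theorem exists_serves (hc : 1 ≤ c) (W : Finset (Fin σ.n)) (p t : ℝ) :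
    ∃ q T, Serves c σ W ∅ p t q T := by
  induction W using Finset.induction_on generalizing p t with
  | empty => exact ⟨p, t, .done p t⟩
  | insert i W hi ih =>
    obtain ⟨q, T, h⟩ := ih (σ.req i).target
      (max (t + |(σ.req i).source - p|) (σ.req i).release + |(σ.req i).target - (σ.req i).source|)
    refine ⟨q, T, .collect i _ (Finset.mem_insert_self i W) ?_ (le_max_left _ _) (le_max_right _ _)
      (.deliver i _ (Finset.mem_insert_self i ∅) le_rfl ?_)⟩
    · simpa using lt_of_lt_of_le one_pos hc
    · simpa [Finset.erase_insert hi] using h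

/-- Up to waiting, there are only finitely many schedules: finitely many completion times
dominate all others. -/
theorem exists_finite_dominating (c : ℕ∞) (σ : RequestSeq) (n : ℕ) :
    ∀ (W K : Finset (Fin σ.n)), 2 * W.card + K.card = n → ∀ p t : ℝ,
      ∃ F : Set ℝ, F.Finite ∧ (∀ T ∈ F, ∃ q, Serves c σ W K p t q T) ∧
        ∀ q T, Serves c σ W K p t q T → ∃ T₀ ∈ F, T₀ ≤ T := by
  induction n using Nat.strong_induction_on with
  | _ n ih =>
    intro W K hn p t
    have hcol : ∀ i : Fin σ.n, ∃ F : Set ℝ, F.Finite ∧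
        (∀ T ∈ F, ∃ q, Serves c σ W K p t q T) ∧
        ∀ t' q T, i ∈ W → (K.card : ℕ∞) < c → t + |(σ.req i).source - p| ≤ t' →
          (σ.req i).release ≤ t' →
          Serves c σ (W.erase i) (insert i K) (σ.req i).source t' q T → ∃ T₀ ∈ F, T₀ ≤ T := by
      intro i
      by_cases hi : i ∈ W ∧ (K.card : ℕ∞) < c
      · have hW := Finset.card_erase_add_one hi.1
        have hK := Finset.card_insert_le i K
        obtain ⟨F, hF, hs, hdom⟩ := ih _ (by omega) (W.erase i) (insert i K) rfl
          (σ.req i).source (max (t + |(σ.req i).source - p|) (σ.req i).release)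
        refine ⟨F, hF, fun T hT => ?_, fun t' q T _ _ hm hr hs' => ?_⟩
        · obtain ⟨q, hq⟩ := hs T hT
          exact ⟨q, .collect i _ hi.1 hi.2 (le_max_left _ _) (le_max_right _ _) hq⟩
        · obtain ⟨T₁, hT₁, hs₁⟩ := hs'.exists_le_of_le (max_le hm hr)
          obtain ⟨T₀, h₀, hle⟩ := hdom q T₁ hs₁
          exact ⟨T₀, h₀, hle.trans hT₁⟩
      · exact ⟨∅, Set.finite_empty, by simp, fun t' q T h1 h2 => absurd ⟨h1, h2⟩ hi⟩
    have hdel : ∀ i : Fin σ.n, ∃ F : Set ℝ, F.Finite ∧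
        (∀ T ∈ F, ∃ q, Serves c σ W K p t q T) ∧
        ∀ t' q T, i ∈ K → t + |(σ.req i).target - p| ≤ t' →
          Serves c σ W (K.erase i) (σ.req i).target t' q T → ∃ T₀ ∈ F, T₀ ≤ T := by
      intro i
      by_cases hi : i ∈ K
      · have hK := Finset.card_erase_add_one hi
        obtain ⟨F, hF, hs, hdom⟩ := ih _ (by omega) W (K.erase i) rfl
          (σ.req i).target (t + |(σ.req i).target - p|)
        refine ⟨F, hF, fun T hT => ?_, fun t' q T _ hm hs' => ?_⟩
        · obtain ⟨q, hq⟩ := hs T hT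
          exact ⟨q, .deliver i _ hi le_rfl hq⟩
        · obtain ⟨T₁, hT₁, hs₁⟩ := hs'.exists_le_of_le hm
          obtain ⟨T₀, h₀, hle⟩ := hdom q T₁ hs₁
          exact ⟨T₀, h₀, hle.trans hT₁⟩
      · exact ⟨∅, Set.finite_empty, by simp, fun t' q T h1 => absurd h1 hi⟩
    choose F hF hFs hFd using hcol
    choose G hG hGs hGd using hdel
    refine ⟨{x | x = t ∧ W = ∅ ∧ K = ∅} ∪ ((⋃ i, F i) ∪ ⋃ i, G i), ?_, ?_, ?_⟩
    · exact ((Set.finite_singleton t).subset fun x hx => hx.1).union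
        ((Set.finite_iUnion hF).union (Set.finite_iUnion hG))
    · rintro T (⟨rfl, rfl, rfl⟩ | hT | hT)
      · exact ⟨p, .done p T⟩
      · obtain ⟨i, hi⟩ := Set.mem_iUnion.1 hT
        exact hFs i T hi
      · obtain ⟨i, hi⟩ := Set.mem_iUnion.1 hT
        exact hGs i T hi
    · intro q T h
      cases h with
      | done => exact ⟨t, Or.inl ⟨rfl, rfl, rfl⟩, le_rfl⟩
      | collect i t' mem cap move rel rest =>
        obtain ⟨T₀, h₀, hle⟩ := hFd i t' q T mem cap move rel rest
        exact ⟨T₀, Or.inr (Or.inl (Set.mem_iUnion.2 ⟨i, h₀⟩)), hle⟩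
      | deliver i t' mem move rest =>
        obtain ⟨T₀, h₀, hle⟩ := hGd i t' q T mem move rest
        exact ⟨T₀, Or.inr (Or.inr (Set.mem_iUnion.2 ⟨i, h₀⟩)), hle⟩

end Schedules

/-! ### The times of the events of a schedule -/

/-- `C` and `D` list the collection and the delivery times of a schedule from position `p` at
time `t` to position `q` at time `T`, in the situation of `Serves c σ W K p t q T`. The server has
unit speed, so positions of events differ by at most the difference of their times. The last two
fields say that the schedule can be restricted: dropping all other requests leaves a schedule for a
subset, which may be entered where and when the first request of the subset is collected. -/
structure IsTimeline (c : ℕ∞) (σ : RequestSeq) (W K : Finset (Fin σ.n)) (p t q T : ℝ)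
    (C D : Fin σ.n → ℝ) : Prop where
  release_le : ∀ i ∈ W, (σ.req i).release ≤ C i
  start_collect : ∀ i ∈ W, t + |(σ.req i).source - p| ≤ C i
  collect_deliver : ∀ i ∈ W, C i + |(σ.req i).target - (σ.req i).source| ≤ D i
  start_deliver : ∀ i ∈ W ∪ K, t + |(σ.req i).target - p| ≤ D i
  deliver_le : ∀ i ∈ W ∪ K, D i ≤ T
  deliver_deliver : ∀ i ∈ W ∪ K, ∀ j ∈ W ∪ K,
    |(σ.req i).target - (σ.req j).target| ≤ |D i - D j|
  collect_deliver_dist : ∀ i ∈ W, ∀ j ∈ W ∪ K,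
    |(σ.req i).source - (σ.req j).target| ≤ |C i - D j|
  exists_last : (W ∪ K).Nonempty → ∃ e ∈ W ∪ K, q = (σ.req e).target ∧ D e = T
  restrict : ∀ R ⊆ W, ∀ K' ⊆ K, (R ∪ K').Nonempty →
    ∃ e ∈ R ∪ K', (∀ j ∈ R ∪ K', D j ≤ D e) ∧ Serves c σ R K' p t (σ.req e).target (D e)
  enter : ∀ R ⊆ W, R.Nonempty → ∃ i ∈ R, ∃ e ∈ R, (∀ j ∈ R, D j ≤ D e) ∧
    Serves c σ R ∅ (σ.req i).source (C i) (σ.req e).target (D e)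

section Timeline

variable {c : ℕ∞} {σ : RequestSeq} {W K : Finset (Fin σ.n)} {p t q T : ℝ}

theorem Serves.exists_timeline (h : Serves c σ W K p t q T) (hWK : Disjoint W K) :
    ∃ C D : Fin σ.n → ℝ, IsTimeline c σ W K p t q T C D := by
  induction h with
  | done p t =>
    refine ⟨fun _ => 0, fun _ => 0, ?_⟩
    constructor <;> simp
  | @collect W K p t q T i t' mem cap move rel rest ih =>
    have hiK : i ∉ K := Finset.disjoint_left.1 hWK mem
    obtain ⟨C, D, H⟩ := ih (by
      rw [Finset.disjoint_left] at hWK ⊢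
      intro j hj hj'
      rw [Finset.mem_erase] at hj
      rcases Finset.mem_insert.1 hj' with rfl | h
      · exact hj.1 rfl
      · exact hWK hj.2 h)
    have hU : W.erase i ∪ insert i K = W ∪ K := by
      ext j
      by_cases hj : j = i <;> simp [hj, mem]
    have hC : ∀ j ∈ W, j ≠ i → j ∈ W.erase i := fun j hj hne => Finset.mem_erase.2 ⟨hne, hj⟩
    refine ⟨Function.update C i t', D, ?_⟩
    constructor
    · intro j hj
      by_cases hji : j = i
      · subst hji; simpa using rel
      · simpa [hji] using H.release_le j (hC j hj hji)
    · intro j hj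
      by_cases hji : j = i
      · subst hji; simpa using move
      · have := H.start_collect j (hC j hj hji)
        have h2 := abs_sub_le (σ.req j).source (σ.req i).source p
        simp only [Function.update_of_ne hji]
        linarith
    · intro j hj
      by_cases hji : j = i
      · subst hji
        simpa using H.start_deliver j (by rw [hU]; exact Finset.mem_union_left _ mem)
      · simpa [hji] using H.collect_deliver j (hC j hj hji)
    · intro j hj
      have := H.start_deliver j (hU ▸ hj)
      have h2 := abs_sub_le (σ.req j).target (σ.req i).source p
      linarith
    · intro j hj
      exact H.deliver_le j (hU ▸ hj)
    · intro j hj k hk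
      exact H.deliver_deliver j (hU ▸ hj) k (hU ▸ hk)
    · intro j hj k hk
      by_cases hji : j = i
      · subst hji
        have := H.start_deliver k (hU ▸ hk)
        simp only [Function.update_self]
        rw [abs_sub_comm, abs_sub_comm t']
        exact le_trans (by linarith) (le_abs_self _)
      · simpa [hji] using H.collect_deliver_dist j (hC j hj hji) k (hU ▸ hk)
    · intro hne
      obtain ⟨e, he, h⟩ := H.exists_last (hU ▸ hne)
      exact ⟨e, hU ▸ he, h⟩
    · intro R hR K' hK' hne
      by_cases hi : i ∈ R
      · have hU' : R.erase i ∪ insert i K' = R ∪ K' := by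
          ext j
          by_cases hj : j = i <;> simp [hj, hi]
        obtain ⟨e, he, hmax, hs⟩ := H.restrict (R.erase i) (Finset.erase_subset_erase i hR)
          (insert i K') (Finset.insert_subset_insert i hK') (hU' ▸ hne)
        refine ⟨e, hU' ▸ he, fun j hj => hmax j (hU' ▸ hj),
          .collect i t' hi (lt_of_le_of_lt ?_ cap) move rel hs⟩
        exact_mod_cast Finset.card_le_card hK'
      · obtain ⟨e, he, hmax, hs⟩ := H.restrict R
          (fun j hj => hC j (hR hj) (fun h => hi (h ▸ hj))) K'
          (hK'.trans (Finset.subset_insert i K)) hne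
        exact ⟨e, he, hmax, hs.prepend hne move⟩
    · intro R hR hne
      by_cases hi : i ∈ R
      · have hU' : R.erase i ∪ insert i ∅ = R := by
          ext j
          by_cases hj : j = i <;> simp [hj, hi]
        obtain ⟨e, he, hmax, hs⟩ := H.restrict (R.erase i) (Finset.erase_subset_erase i hR)
          (insert i ∅) (Finset.insert_subset_insert i (Finset.empty_subset K)) (hU'.symm ▸ hne)
        refine ⟨i, hi, e, hU' ▸ he, fun j hj => hmax j (hU'.symm ▸ hj), ?_⟩
        rw [Function.update_self]
        exact .collect i t' hi (lt_of_le_of_lt (by simp) cap) (by simp) rel hs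
      · obtain ⟨k, hk, e, he, hmax, hs⟩ := H.enter R
          (fun j hj => hC j (hR hj) (fun h => hi (h ▸ hj))) hne
        refine ⟨k, hk, e, he, hmax, ?_⟩
        rwa [Function.update_of_ne (by rintro rfl; exact hi hk)]
  | @deliver W K p t q T i t' mem move rest ih =>
    have hiW : i ∉ W := Finset.disjoint_right.1 hWK mem
    obtain ⟨C, D, H⟩ := ih (hWK.mono_right (Finset.erase_subset i K))
    have hU : ∀ j ∈ W ∪ K, j ≠ i → j ∈ W ∪ K.erase i := fun j hj hne => by
      simpa [hne] using hj
    have hW : ∀ j ∈ W, j ≠ i := fun j hj h => hiW (h ▸ hj)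
    have htT := rest.start_le
    have hDt : ∀ j ∈ W ∪ K.erase i, t' ≤ D j := fun j hj => by
      linarith [H.start_deliver j hj, abs_nonneg ((σ.req j).target - (σ.req i).target)]
    have hdist : ∀ j ∈ W ∪ K.erase i,
        |(σ.req j).target - (σ.req i).target| ≤ |D j - t'| := fun j hj =>
      le_trans (by linarith [H.start_deliver j hj]) (le_abs_self _)
    refine ⟨C, Function.update D i t', ?_⟩
    constructor
    · exact H.release_le
    · intro j hj
      have := H.start_collect j hj
      have h2 := abs_sub_le (σ.req j).source (σ.req i).target p
      linarith
    · intro j hj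
      simpa [hW j hj] using H.collect_deliver j hj
    · intro j hj
      by_cases hji : j = i
      · subst hji; simpa using move
      · have := H.start_deliver j (hU j hj hji)
        have h2 := abs_sub_le (σ.req j).target (σ.req i).target p
        simp only [Function.update_of_ne hji]
        linarith
    · intro j hj
      by_cases hji : j = i
      · subst hji; simpa using htT
      · simpa [hji] using H.deliver_le j (hU j hj hji)
    · intro j hj k hk
      by_cases hji : j = i
      · subst hji
        by_cases hkj : k = j
        · subst hkj; simp
        · simp only [Function.update_self, Function.update_of_ne hkj]
          rw [abs_sub_comm, abs_sub_comm t']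
          exact hdist k (hU k hk hkj)
      · by_cases hki : k = i
        · subst hki
          simpa [hji] using hdist j (hU j hj hji)
        · simpa [hji, hki] using H.deliver_deliver j (hU j hj hji) k (hU k hk hki)
    · intro j hj k hk
      by_cases hki : k = i
      · subst hki
        simp only [Function.update_self]
        exact le_trans (by linarith [H.start_collect j hj]) (le_abs_self _)
      · simpa [hki] using H.collect_deliver_dist j hj k (hU k hk hki)
    · intro _
      by_cases hne : (W ∪ K.erase i).Nonempty
      · obtain ⟨e, he, hq, hT⟩ := H.exists_last hne
        have hei : e ≠ i := by
          rintro rfl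
          simp [hiW] at he
        refine ⟨e, ?_, hq, by simpa [hei] using hT⟩
        rcases Finset.mem_union.1 he with h | h
        · exact Finset.mem_union_left _ h
        · exact Finset.mem_union_right _ (Finset.mem_of_mem_erase h)
      · -- the delivery of `i` is the last event
        refine ⟨i, Finset.mem_union_right _ mem, ?_⟩
        rw [Finset.not_nonempty_iff_eq_empty, Finset.union_eq_empty] at hne
        rw [hne.1, hne.2] at rest
        cases rest with
        | done => simp
        | collect j t'' mem' => simp at mem'
        | deliver j t'' mem' => simp at mem'
    · intro R hR K' hK' hne
      have hiR : i ∉ R := fun h => hiW (hR h)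
      by_cases hi : i ∈ K'
      · by_cases hne' : (R ∪ K'.erase i).Nonempty
        · obtain ⟨e, he, hmax, hs⟩ := H.restrict R hR (K'.erase i)
            (Finset.erase_subset_erase i hK') hne'
          have hei : e ≠ i := by
            rintro rfl
            simp [hiR] at he
          have he' : e ∈ R ∪ K' := by
            rcases Finset.mem_union.1 he with h | h
            · exact Finset.mem_union_left _ h
            · exact Finset.mem_union_right _ (Finset.mem_of_mem_erase h)
          refine ⟨e, he', fun j hj => ?_, ?_⟩
          · rw [Function.update_of_ne hei]
            by_cases hji : j = i
            · subst hji
              rw [Function.update_self]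
              exact hs.start_le
            · rw [Function.update_of_ne hji]
              exact hmax j (by simpa [hji] using hj)
          · rw [Function.update_of_ne hei]
            exact .deliver i t' hi move hs
        · rw [Finset.not_nonempty_iff_eq_empty, Finset.union_eq_empty] at hne'
          refine ⟨i, Finset.mem_union_right _ hi, fun j hj => ?_, ?_⟩
          · by_cases hji : j = i
            · rw [hji]
            · exfalso
              have : j ∈ R ∪ K'.erase i := by simpa [hji] using hj
              simp [hne'.1, hne'.2] at this
          · rw [Function.update_self]
            refine .deliver i t' hi move ?_
            rw [hne'.1, hne'.2]
            exact .done _ _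
      · have hK'' : K' ⊆ K.erase i := fun j hj =>
          Finset.mem_erase.2 ⟨fun h => hi (h ▸ hj), hK' hj⟩
        obtain ⟨e, he, hmax, hs⟩ := H.restrict R hR K' hK'' hne
        have hne_i : ∀ j ∈ R ∪ K', j ≠ i := by
          rintro j hj rfl
          simp [hiR, hi] at hj
        refine ⟨e, he, fun j hj => ?_, ?_⟩
        · rw [Function.update_of_ne (hne_i j hj), Function.update_of_ne (hne_i e he)]
          exact hmax j hj
        · rw [Function.update_of_ne (hne_i e he)]
          exact hs.prepend hne move
    · intro R hR hne
      obtain ⟨k, hk, e, he, hmax, hs⟩ := H.enter R hR hne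
      refine ⟨k, hk, e, he, fun j hj => ?_, ?_⟩
      · rw [Function.update_of_ne (hW j (hR hj)), Function.update_of_ne (hW e (hR he))]
        exact hmax j hj
      · rwa [Function.update_of_ne (hW e (hR he))]

theorem Serves.exists_timeline_of_empty (h : Serves c σ W ∅ p t q T) :
    ∃ C D : Fin σ.n → ℝ, IsTimeline c σ W ∅ p t q T C D :=
  h.exists_timeline (Finset.disjoint_empty_right W)

end Timeline

/-! ### Optimal schedules -/

section MinLength

variable {c : ℕ∞} {σ : RequestSeq} {R : Finset (Fin σ.n)} {p t q T : ℝ}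

theorem minLength_le (h : Serves c σ R ∅ p t q T) : minLength c σ t p R ≤ T - t := by
  refine csInf_le ⟨0, ?_⟩ ⟨q, by simpa using h⟩
  rintro l ⟨q', h'⟩
  linarith [h'.start_le]

theorem exists_serves_minLength (hc : 1 ≤ c) (t p : ℝ) (R : Finset (Fin σ.n)) :
    ∃ q, Serves c σ R ∅ p t q (t + minLength c σ t p R) := by
  obtain ⟨F, hF, hs, hdom⟩ := exists_finite_dominating c σ _ R ∅ rfl p t
  obtain ⟨q₁, T₁, h₁⟩ := exists_serves (σ := σ) hc R p t
  obtain ⟨T₂, hT₂, -⟩ := hdom q₁ T₁ h₁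
  obtain ⟨T₀, hT₀, hmin⟩ := hF.exists_minimalFor id F ⟨T₂, hT₂⟩
  obtain ⟨q, hq⟩ := hs T₀ hT₀
  have hle : ∀ q' T', Serves c σ R ∅ p t q' T' → T₀ ≤ T' := by
    intro q' T' h'
    obtain ⟨T₃, hT₃, h₃⟩ := hdom q' T' h'
    rcases le_total T₀ T₃ with h | h
    · exact h.trans h₃
    · exact le_trans (hmin hT₃ h) h₃
  refine ⟨q, ?_⟩
  have : minLength c σ t p R = T₀ - t := by
    refine le_antisymm (minLength_le hq) (le_csInf ⟨T₀ - t, q, by simpa using hq⟩ ?_)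
    rintro l ⟨q', h'⟩
    linarith [hle q' _ h']
  rw [this]
  simpa using hq

theorem le_minLength (hc : 1 ≤ c) {x : ℝ} (h : ∀ q T, Serves c σ R ∅ p t q T → t + x ≤ T) :
    x ≤ minLength c σ t p R := by
  obtain ⟨q, hq⟩ := exists_serves_minLength (σ := σ) hc t p R
  linarith [h q _ hq]

theorem minLength_nonneg : 0 ≤ minLength c σ t p R := by
  refine Real.sInf_nonneg ?_
  rintro l ⟨q, h⟩
  linarith [h.start_le]

theorem minLength_mono (hc : 1 ≤ c) {R' : Finset (Fin σ.n)} (h : R ⊆ R') :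
    minLength c σ t p R ≤ minLength c σ t p R' := by
  rcases R.eq_empty_or_nonempty with rfl | hne
  · exact (minLength_le (.done p t)).trans (by simpa using minLength_nonneg)
  · refine le_minLength hc fun q T hs => ?_
    obtain ⟨C, D, H⟩ := hs.exists_timeline_of_empty
    obtain ⟨e, he, -, hs'⟩ := H.restrict R h ∅ subset_rfl (by simpa using hne)
    have := H.deliver_le e (Finset.mem_union_left _ (h (by simpa using he)))
    linarith [minLength_le hs']

theorem minLength_le_dist_add (hc : 1 ≤ c) (hR : ∀ i ∈ R, (σ.req i).release ≤ t) (x : ℝ) :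
    minLength c σ t p R ≤ |x - p| + minLength c σ t x R := by
  rcases R.eq_empty_or_nonempty with rfl | hne
  · refine (minLength_le (.done p t)).trans ?_
    rw [sub_self]
    exact add_nonneg (abs_nonneg _) minLength_nonneg
  · obtain ⟨q, hq⟩ := exists_serves_minLength (σ := σ) hc t x R
    have h1 := (hq.translate |x - p| fun i hi => by linarith [hR i hi, abs_nonneg (x - p)])
    linarith [minLength_le (h1.prepend (p := p) (by simpa using hne) le_rfl)]

/-- Once all requests are released, the optimal length no longer depends on the time. -/
theorem minLength_le_of_released (hc : 1 ≤ c) {t' : ℝ}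
    (hR : ∀ i ∈ R, (σ.req i).release ≤ t') :
    minLength c σ t' p R ≤ minLength c σ t p R := by
  obtain ⟨q, hq⟩ := exists_serves_minLength (σ := σ) hc t p R
  have := minLength_le (hq.translate (t' - t) fun i hi => by linarith [hR i hi])
  rw [show t + (t' - t) = t' by ring] at this
  linarith

theorem minLength_congr_time (hc : 1 ≤ c) {t' : ℝ} (hR : ∀ i ∈ R, (σ.req i).release ≤ t)
    (hR' : ∀ i ∈ R, (σ.req i).release ≤ t') :
    minLength c σ t p R = minLength c σ t' p R :=
  le_antisymm (minLength_le_of_released hc hR) (minLength_le_of_released hc hR')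

theorem dist_target_le_minLength (hc : 1 ≤ c) {i : Fin σ.n} (hi : i ∈ R) :
    |(σ.req i).target - p| ≤ minLength c σ t p R := by
  refine le_minLength hc fun q T h => ?_
  obtain ⟨C, D, H⟩ := h.exists_timeline_of_empty
  have hi' : i ∈ R ∪ ∅ := Finset.mem_union_left _ hi
  exact (H.start_deliver i hi').trans (H.deliver_le i hi')

end MinLength

@[simp] theorem mem_releasedUntil {σ : RequestSeq} {t : ℝ} {i : Fin σ.n} :
    i ∈ releasedUntil σ t ↔ (σ.req i).release ≤ t := by
  simp [releasedUntil]

theorem releasedUntil_mono {σ : RequestSeq} {s t : ℝ} (h : s ≤ t) :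
    releasedUntil σ s ⊆ releasedUntil σ t := by
  intro i hi
  rw [mem_releasedUntil] at hi ⊢
  exact hi.trans h

/-! ### Executions of SmarterStart -/

section Execution

variable {c : ℕ∞} {σ : RequestSeq}

theorem exists_release_le (σ : RequestSeq) : ∃ M : ℝ, ∀ i, (σ.req i).release ≤ M := by
  obtain ⟨M, hM⟩ := (Set.finite_range fun i => (σ.req i).release).bddAbove
  exact ⟨M, fun i => hM ⟨i, rfl⟩⟩

/-- The next schedule has a well-defined starting time: the starting condition depends on the time
only through the set of released requests, which takes finitely many values, and among the times
with a given set of released requests the condition cuts out a closed half-line. -/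
theorem exists_isLeast_start (hc : 1 ≤ c) (Θ : ℝ) {D : Finset (Fin σ.n)}
    (hD : D ≠ Finset.univ) (t : ℝ) :
    ∃ s, IsLeast {s' : ℝ | t ≤ s' ∧ (releasedUntil σ s' \ D).Nonempty ∧
        minLength c σ s' 0 (releasedUntil σ s') / (Θ - 1) ≤ s'} s := by
  classical
  obtain ⟨M, hM⟩ := exists_release_le σ
  set l : Finset (Fin σ.n) → ℝ := fun A => minLength c σ M 0 A / (Θ - 1) with hl
  have hlen : ∀ s, minLength c σ s 0 (releasedUntil σ s) / (Θ - 1) = l (releasedUntil σ s) := by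
    intro s
    rw [hl, minLength_congr_time (t' := M) hc (fun i hi => mem_releasedUntil.1 hi)
      (fun i _ => hM i)]
  simp only [hlen]
  set S := {s' : ℝ | t ≤ s' ∧ (releasedUntil σ s' \ D).Nonempty ∧ l (releasedUntil σ s') ≤ s'}
    with hS
  let φ : Finset (Fin σ.n) → ℝ := fun A =>
    (insert t (insert (l A) (A.image fun i => (σ.req i).release))).max' (Finset.insert_nonempty _ _)
  have hφ : ∀ A s, φ A ≤ s ↔ t ≤ s ∧ l A ≤ s ∧ ∀ i ∈ A, (σ.req i).release ≤ s := by
    intro A s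
    simp [φ, Finset.max'_le_iff]
  have hle : ∀ s ∈ S, φ (releasedUntil σ s) ≤ s := fun s hs =>
    (hφ _ _).2 ⟨hs.1, hs.2.2, fun i hi => mem_releasedUntil.1 hi⟩
  have hne : S.Nonempty := by
    have hu : releasedUntil σ (max t (max M (l Finset.univ))) = Finset.univ := by
      ext i
      simp [hM i]
    refine ⟨max t (max M (l Finset.univ)), le_max_left _ _, ?_, ?_⟩
    · rw [hu, Finset.sdiff_nonempty, Finset.univ_subset_iff]
      exact hD
    · rw [hu]
      exact (le_max_right _ _).trans (le_max_right _ _)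
  obtain ⟨s₁, hs₁⟩ := hne
  obtain ⟨A, hA, hmin⟩ := Finset.exists_min_image
    (Finset.univ.filter fun A => ∃ s ∈ S, releasedUntil σ s = A) φ
    ⟨releasedUntil σ s₁, by simpa using ⟨s₁, hs₁, rfl⟩⟩
  obtain ⟨s₀, hs₀, rfl⟩ := (Finset.mem_filter.1 hA).2
  have hself := (hφ (releasedUntil σ s₀) _).1 le_rfl
  have hrel : releasedUntil σ (φ (releasedUntil σ s₀)) = releasedUntil σ s₀ := by
    refine subset_antisymm (releasedUntil_mono (hle s₀ hs₀)) fun i hi => ?_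
    exact mem_releasedUntil.2 (hself.2.2 i hi)
  refine ⟨φ (releasedUntil σ s₀), ⟨hself.1, ?_, ?_⟩, fun s hs => ?_⟩
  · rw [hrel]
    exact hs₀.2.1
  · rw [hrel]
    exact hself.2.1
  · exact (hmin _ (Finset.mem_filter.2 ⟨Finset.mem_univ _, s, hs, rfl⟩)).trans (hle s hs)

theorem exists_smarterStartFrom (hc : 1 ≤ c) (Θ : ℝ) (σ : RequestSeq) (n : ℕ) :
    ∀ D : Finset (Fin σ.n), (Dᶜ).card = n → ∀ p t : ℝ, ∃ T, SmarterStartFrom c Θ σ D p t T := by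
  induction n using Nat.strong_induction_on with
  | _ n ih =>
    intro D hn p t
    by_cases hD : D = Finset.univ
    · subst hD
      exact ⟨t, .finished p t⟩
    · obtain ⟨s, hs⟩ := exists_isLeast_start hc Θ hD t
      obtain ⟨q, hq⟩ := exists_serves_minLength (σ := σ) hc s p (releasedUntil σ s \ D)
      obtain ⟨i, hi⟩ := hs.1.2.1
      rw [Finset.mem_sdiff] at hi
      have hlt : ((D ∪ releasedUntil σ s)ᶜ).card < n := by
        rw [← hn]
        refine Finset.card_lt_card (Finset.compl_ssubset_compl.2 ?_)
        exact Finset.ssubset_iff_subset_ne.2 ⟨Finset.subset_union_left, fun h =>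
          hi.2 (h ▸ Finset.mem_union_right _ hi.1)⟩
      obtain ⟨T, hT⟩ := ih _ hlt _ rfl q (s + minLength c σ s p (releasedUntil σ s \ D))
      exact ⟨T, .schedule s q hs hq hT⟩

theorem exists_isCompletionTime (hc : 1 ≤ c) (Θ : ℝ) (σ : RequestSeq) :
    ∃ T, IsCompletionTime c Θ σ T :=
  exists_smarterStartFrom hc Θ σ _ ∅ rfl 0 0

end Execution

/-! ### Comparison with the optimal offline schedule -/

section Offline

variable {c : ℕ∞} {Θ : ℝ} {σ : RequestSeq} {C D : Fin σ.n → ℝ} {q o : ℝ}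

/-- Following another schedule: to serve released requests `R`, the server can go to the place where
that schedule collects its first request of `R`, and continue as it does up to its last delivery of
a request of `R`. -/
theorem IsTimeline.exists_minLength_le {W : Finset (Fin σ.n)} {p₀ t₀ : ℝ}
    (H : IsTimeline c σ W ∅ p₀ t₀ q o C D)
    {R : Finset (Fin σ.n)} (hRW : R ⊆ W) (hne : R.Nonempty) {s p : ℝ}
    (hR : ∀ i ∈ R, (σ.req i).release ≤ s) :
    ∃ i ∈ R, ∃ e ∈ R, (∀ j ∈ R, D j ≤ D e) ∧
      minLength c σ s p R ≤ |p - (σ.req i).source| + D e - C i := by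
  obtain ⟨i, hi, e, he, hmax, hs⟩ := H.enter R hRW hne
  refine ⟨i, hi, e, he, hmax, ?_⟩
  have h1 := hs.translate (s + |(σ.req i).source - p| - C i) fun j hj => by
    linarith [hR j hj, abs_nonneg ((σ.req i).source - p)]
  have h2 := minLength_le (h1.prepend (p := p) (t₀ := s) (by simpa using hne) (by linarith))
  rw [abs_sub_comm]
  linarith

theorem minLength_le_opt (hc : 1 ≤ c) {R : Finset (Fin σ.n)} {s : ℝ}
    (hR : ∀ i ∈ R, (σ.req i).release ≤ s) : minLength c σ s 0 R ≤ opt c σ :=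
  (minLength_le_of_released hc hR).trans (minLength_mono hc (Finset.subset_univ R))

theorem opt_le {q T : ℝ} (h : Serves c σ Finset.univ ∅ 0 0 q T) : opt c σ ≤ T :=
  (minLength_le h).trans_eq (sub_zero T)

theorem opt_nonneg : 0 ≤ opt c σ := minLength_nonneg

theorem exists_opt_timeline (hc : 1 ≤ c) (σ : RequestSeq) :
    ∃ q C D, IsTimeline c σ Finset.univ ∅ 0 0 q (opt c σ) C D := by
  obtain ⟨q, hq⟩ := exists_serves_minLength (σ := σ) hc 0 0 Finset.univ
  obtain ⟨C, D, H⟩ := hq.exists_timeline_of_empty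
  rw [zero_add] at H
  exact ⟨q, C, D, H⟩

theorem release_le_opt (hc : 1 ≤ c) (i : Fin σ.n) : (σ.req i).release ≤ opt c σ := by
  obtain ⟨q, C, D, H⟩ := exists_opt_timeline hc σ
  have h1 := H.release_le i (Finset.mem_univ i)
  have h2 := H.collect_deliver i (Finset.mem_univ i)
  have h3 := H.deliver_le i (by simp)
  linarith [abs_nonneg ((σ.req i).target - (σ.req i).source)]

/-- If SmarterStart waits before it starts a schedule at time `s`, then `s ≤ Opt / (Θ - 1)`: at that
time everything is released and the waiting condition holds. -/
theorem start_le_of_lt (hc : 1 ≤ c) (hΘ : 1 < Θ) (hΘ' : Θ ≤ 2) {A : Finset (Fin σ.n)} {t s : ℝ}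
    (hs : IsLeast {s' : ℝ | t ≤ s' ∧ (releasedUntil σ s' \ A).Nonempty ∧
        minLength c σ s' 0 (releasedUntil σ s') / (Θ - 1) ≤ s'} s) (hts : t < s) :
    s * (Θ - 1) ≤ opt c σ := by
  by_contra! hlt
  have hpos : 0 < Θ - 1 := by linarith
  have hlt' : opt c σ / (Θ - 1) < s := by rwa [div_lt_iff₀ hpos]
  set s' := max t (opt c σ / (Θ - 1)) with hs'
  have hs's : s' < s := max_lt hts hlt'
  have ho : opt c σ ≤ opt c σ / (Θ - 1) := by
    rw [le_div_iff₀ hpos]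
    nlinarith [opt_nonneg (c := c) (σ := σ)]
  have hrel : ∀ i, (σ.req i).release ≤ s' := fun i =>
    (release_le_opt hc i).trans (ho.trans (le_max_right _ _))
  have hmem : s' ∈ {s' : ℝ | t ≤ s' ∧ (releasedUntil σ s' \ A).Nonempty ∧
        minLength c σ s' 0 (releasedUntil σ s') / (Θ - 1) ≤ s'} := by
    refine ⟨le_max_left _ _, hs.1.2.1.mono ?_, ?_⟩
    · refine Finset.sdiff_subset_sdiff (fun i _ => mem_releasedUntil.2 (hrel i)) le_rfl
    · refine le_trans ?_ (le_max_right _ _)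
      exact div_le_div_of_nonneg_right
        (minLength_le_opt hc fun i hi => mem_releasedUntil.1 hi) hpos.le
  exact absurd (hs.2 hmem) (not_le.2 hs's)

end Offline

/-! ### The upper bound -/

/-- The competitive ratio `ρ` is at least `fWait Θ`: the case of waiting. Here `o` is the optimal
cost, the last schedule starts at time `s` in position `p` and has length `Y`, the previous one
started at time `u`; the optimal schedule is in `p` at time `b`, and it collects its first request
of the last schedule in position `a` at time `τ`. -/
theorem wait_bound {Θ ρ o s u p a τ b Y : ℝ} (hΘ : 1 < Θ)
    (hρ : fWait Θ ≤ ρ) (hs : s * (Θ - 1) ≤ o) (ho : 0 ≤ o) (hb : b ≤ o)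
    (hY : Y ≤ |p - a| + o - τ) (hτu : u ≤ τ) (hτa : |a| ≤ τ)
    (hpu : |p| ≤ (Θ - 1) * u) (hpb : |p| ≤ b) (hab : |a - p| ≤ |τ - b|) : s + Y ≤ ρ * o := by
  have h1 : 0 < Θ - 1 := by linarith
  have h2 : 0 < Θ + 1 := by linarith
  have hf : fWait Θ = Θ / (Θ - 1) + (Θ - 1) / (Θ + 1) := by
    unfold fWait
    rw [div_add_div _ _ h1.ne' h2.ne', div_eq_div_iff (by nlinarith) (by positivity)]
    ring
  have hs' : s ≤ o / (Θ - 1) := by rwa [le_div_iff₀ h1]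
  have hx : Θ / (Θ - 1) * o = o / (Θ - 1) + o := by
    field_simp
    ring
  have hu : 0 ≤ u := by
    by_contra hu
    nlinarith [abs_nonneg p]
  suffices h : |p - a| - τ ≤ (Θ - 1) / (Θ + 1) * o by
    calc s + Y ≤ fWait Θ * o := by
          rw [hf, add_mul, hx]
          linarith
      _ ≤ ρ * o := mul_le_mul_of_nonneg_right hρ ho
  rw [div_mul_eq_mul_div, le_div_iff₀ h2]
  have htri : |p - a| ≤ |p| + |a| := abs_sub p a
  rw [abs_sub_comm a p] at hab
  generalize |p - a| = d at *
  rcases le_total τ b with hτb | hτb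
  · -- the optimal schedule visits `p` after `a`
    rw [abs_of_nonpos (by linarith : τ - b ≤ 0)] at hab
    have h3 : d ≤ Θ * τ := by nlinarith [mul_le_mul_of_nonneg_left hτu h1.le]
    nlinarith [mul_le_mul_of_nonneg_left (by linarith : d + τ ≤ o) h1.le]
  · -- it visits `p` before `a`, so that `|p - a| ≤ τ`
    rw [abs_of_nonneg (by linarith : 0 ≤ τ - b)] at hab
    nlinarith [abs_nonneg p, mul_nonneg h1.le ho]

/-- The competitive ratio `ρ` is at least `fNoWait Θ`: the case without waiting. Here `o` is the
optimal cost. The last but one schedule starts at time `u` in position `p₀` and has length `X`, and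
the one before started at time `v`. The last schedule starts at time `u + X` in position `p` and has
length `Y`; the optimal schedule delivers in `p` at time `b`, collects its first request of the last
schedule in position `a` at time `τ`, and delivers its last request of the previous schedule in
position `e` at time `b'`. -/
theorem no_wait_bound {Θ ρ o v u X Y p₀ p a e τ b b' : ℝ} (hΘ : 1 < Θ) (hΘ' : Θ ≤ 2)
    (hρ : fNoWait Θ ≤ ρ) (hτo : τ ≤ o) (hb : b ≤ o) (hb' : b' ≤ o)
    (hv : 0 ≤ v) (hvu : v ≤ u) (huτ : u ≤ τ) (hp₀ : |p₀| ≤ (Θ - 1) * v)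
    (hX : X ≤ |p₀| + (Θ - 1) * u) (hX' : X ≤ |p₀| + b')
    (hXe : |e - p₀| + |p - e| ≤ X) (hY : Y ≤ |p - a| + o - τ)
    (hvb : v ≤ b) (hpb : |p| ≤ b) (hab : |a - p| ≤ |τ - b|) (hae : |a - e| ≤ |τ - b'|) :
    u + X + Y ≤ ρ * o := by
  have ho : 0 ≤ o := by linarith
  have h2 : 0 < 2 * Θ + 1 := by linarith
  suffices h : (2 * Θ + 1) * (u + X + Y) ≤ (3 * Θ ^ 2 + 3) * o by
    calc u + X + Y ≤ fNoWait Θ * o := by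
          rw [fNoWait, div_mul_eq_mul_div, le_div_iff₀ h2]
          linarith
      _ ≤ ρ * o := mul_le_mul_of_nonneg_right hρ ho
  have hp₀u : |p₀| ≤ (Θ - 1) * u := hp₀.trans (mul_le_mul_of_nonneg_left hvu (by linarith))
  -- the previous schedule visits both `e` and `p`, in this order
  have hpe : 2 * |p - e| ≤ X + |p₀| + |p| := by
    have h3 := abs_sub_le p p₀ e
    have h4 := abs_sub p p₀
    rw [abs_sub_comm p₀ e] at h3
    linarith
  have hpa : |p - a| ≤ |p - e| + |a - e| := by
    rw [abs_sub_comm a e]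
    exact abs_sub_le p e a
  rw [abs_sub_comm a p] at hab
  have hp := abs_nonneg p
  generalize |p - a| = d at *
  generalize |p - e| = f at *
  generalize |p₀| = P₀ at *
  generalize |p| = P at *
  rcases lt_or_ge τ b with hτb | hτb
  · -- the optimal schedule visits `p` after `a`
    rw [abs_of_nonpos (by linarith : τ - b ≤ 0)] at hab
    have h3 : u + X + Y ≤ 2 * o + (2 * Θ - 3) * u := by nlinarith
    rcases le_total (2 * Θ - 3) 0 with h4 | h4
    · have h5 : u + X + Y ≤ 2 * o := by nlinarith
      nlinarith [mul_le_mul_of_nonneg_left h5 h2.le,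
        mul_nonneg (mul_nonneg (by linarith : 0 ≤ 3 * Θ - 1) (by linarith : 0 ≤ Θ - 1)) ho]
    · have h5 : u + X + Y ≤ (2 * Θ - 1) * o := by nlinarith
      nlinarith [mul_le_mul_of_nonneg_left h5 h2.le,
        mul_nonneg (mul_nonneg (by linarith : 0 ≤ 2 - Θ) (by linarith : 0 ≤ 2 + Θ)) ho]
  rw [abs_of_nonneg (by linarith : 0 ≤ τ - b)] at hab
  -- now `M = max v |p|` decides which of two estimates is the better one
  set M := max v P with hM
  have hvM : v ≤ M := le_max_left _ _
  have hPM : P ≤ M := le_max_right _ _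
  have hMb : M ≤ b := max_le hvb hpb
  have hP₀M : P₀ ≤ (Θ - 1) * M := hp₀.trans (mul_le_mul_of_nonneg_left hvM (by linarith))
  rcases le_total ((Θ - 1) * o) ((2 * Θ + 1) * M) with hc | hc
  · have h3 : u + X + Y ≤ (1 + Θ) * o - (2 - Θ) * M := by nlinarith
    nlinarith [mul_le_mul_of_nonneg_left h3 h2.le,
      mul_le_mul_of_nonneg_left hc (by linarith : 0 ≤ 2 - Θ)]
  · have h3 : u + X + Y ≤ (3 + Θ) / 2 * o + (4 * Θ - 3) / 2 * M := by
      have hf : f ≤ ((Θ - 1) * u + 2 * P₀ + P) / 2 := by linarith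
      have huo : (Θ - 1) * u ≤ (Θ - 1) * o :=
        mul_le_mul_of_nonneg_left (huτ.trans hτo) (by linarith)
      rcases le_total b' τ with hbτ | hbτ
      · rw [abs_of_nonneg (by linarith : 0 ≤ τ - b')] at hae
        linarith
      · -- the last delivery of the previous schedule comes after `a`
        rw [abs_of_nonpos (by linarith : τ - b' ≤ 0)] at hae
        have h4 : u + X + Y ≤ 2 * o + (3 * Θ - 5) / 2 * u + 2 * P₀ + P / 2 := by nlinarith
        have h5 : 0 ≤ (2 - Θ) * (o - u) := mul_nonneg (by linarith) (by linarith)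
        nlinarith
    linarith [mul_le_mul_of_nonneg_left h3 h2.le,
      mul_le_mul_of_nonneg_left hc (by linarith : 0 ≤ 4 * Θ - 3)]

/-- SmarterStart has just finished a schedule: it started at time `u` in position `p₀`, served the
requests `R` and ended at time `t` in position `p`, so that now exactly the requests `A` are served.
Of the schedule before, only its starting time `v` is recorded: the requests `R` were not released before
it, and it ended at a target that an optimal schedule from the origin at time `v` would visit, hence
the bound on `p₀`. For the first schedule `v = 0` and `p₀ = 0`. -/
structure IsLastSchedule (c : ℕ∞) (Θ : ℝ) (σ : RequestSeq) (A : Finset (Fin σ.n))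
    (p t v u p₀ : ℝ) (R : Finset (Fin σ.n)) : Prop where
  nonneg : 0 ≤ v
  le : v ≤ u
  abs_le : |p₀| ≤ (Θ - 1) * v
  le_release : ∀ i ∈ R, v ≤ (σ.req i).release
  served : A = releasedUntil σ u
  subset : R ⊆ A
  nonempty : R.Nonempty
  start : minLength c σ u 0 A ≤ (Θ - 1) * u
  serves : Serves c σ R ∅ p₀ u p t
  length : minLength c σ u p₀ R = t - u

namespace IsLastSchedule

variable {c : ℕ∞} {Θ ρ : ℝ} {σ : RequestSeq} {A R : Finset (Fin σ.n)} {p t v u p₀ s : ℝ}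

theorem released (h : IsLastSchedule c Θ σ A p t v u p₀ R) :
    ∀ i ∈ R, (σ.req i).release ≤ u := fun i hi => by
  have := h.subset hi
  rwa [h.served, mem_releasedUntil] at this

theorem exists_target (h : IsLastSchedule c Θ σ A p t v u p₀ R) :
    ∃ j ∈ R, p = (σ.req j).target ∧
      ∀ i ∈ R, |(σ.req i).target - p₀| + |p - (σ.req i).target| ≤ t - u := by
  obtain ⟨C, D, H⟩ := h.serves.exists_timeline_of_empty
  have hR : ∀ i ∈ R, i ∈ R ∪ ∅ := fun i hi => Finset.mem_union_left _ hi
  obtain ⟨j, hj, hp, hDj⟩ := H.exists_last (by simpa using h.nonempty)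
  refine ⟨j, by simpa using hj, hp, fun i hi => ?_⟩
  have h1 := H.start_deliver i (hR i hi)
  have h2 := H.deliver_deliver j hj i (hR i hi)
  rw [hDj, abs_of_nonneg (sub_nonneg.2 (H.deliver_le i (hR i hi)))] at h2
  rw [hp]
  linarith

theorem abs_end_le (hc : 1 ≤ c) (h : IsLastSchedule c Θ σ A p t v u p₀ R) :
    |p| ≤ (Θ - 1) * u := by
  obtain ⟨j, hj, hp, -⟩ := h.exists_target
  have := dist_target_le_minLength (σ := σ) (p := 0) (t := u) hc (h.subset hj)
  rw [hp]
  rw [sub_zero] at this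
  exact this.trans h.start

theorem length_le (hc : 1 ≤ c) (h : IsLastSchedule c Θ σ A p t v u p₀ R) :
    t - u ≤ |p₀| + (Θ - 1) * u := by
  have h1 := minLength_le_dist_add (p := p₀) hc h.released 0
  have h2 := minLength_mono (σ := σ) (p := 0) (t := u) hc h.subset
  rw [zero_sub, abs_neg] at h1
  linarith [h.start, h.length]

theorem next_length_le (hc : 1 ≤ c) (hΘ : 1 < Θ) (hΘ' : Θ ≤ 2) (hρ₁ : fWait Θ ≤ ρ)
    (hρ₂ : fNoWait Θ ≤ ρ) (h : IsLastSchedule c Θ σ A p t v u p₀ R)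
    (hs : IsLeast {s' : ℝ | t ≤ s' ∧ (releasedUntil σ s' \ A).Nonempty ∧
        minLength c σ s' 0 (releasedUntil σ s') / (Θ - 1) ≤ s'} s) :
    s + minLength c σ s p (releasedUntil σ s \ A) ≤ ρ * opt c σ := by
  obtain ⟨q, C, D, H⟩ := exists_opt_timeline hc σ
  have hU : ∀ i : Fin σ.n, i ∈ (Finset.univ ∪ ∅ : Finset (Fin σ.n)) := by simp
  have hD : ∀ i, D i ≤ opt c σ := fun i => H.deliver_le i (hU i)
  have hCD : ∀ i, C i ≤ D i := fun i => by
    linarith [H.collect_deliver i (Finset.mem_univ i),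
      abs_nonneg ((σ.req i).target - (σ.req i).source)]
  have hC0 : ∀ i, |(σ.req i).source| ≤ C i := fun i => by
    simpa using H.start_collect i (Finset.mem_univ i)
  -- `i` is the first request of the new schedule that the optimal schedule collects
  obtain ⟨i, hi, k, hk, -, hY⟩ := H.exists_minLength_le (Finset.subset_univ _) hs.1.2.1
    (s := s) (p := p) fun i hi => mem_releasedUntil.1 (Finset.mem_sdiff.1 hi).1
  have hui : u ≤ C i := by
    have h1 := (Finset.mem_sdiff.1 hi).2
    rw [h.served, mem_releasedUntil, not_le] at h1
    exact h1.le.trans (H.release_le i (Finset.mem_univ i))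
  have hY' : minLength c σ s p (releasedUntil σ s \ A) ≤
      |p - (σ.req i).source| + opt c σ - C i := by linarith [hD k]
  obtain ⟨j, hj, hp, hXe⟩ := h.exists_target
  have hpj : |p| ≤ D j := by simpa [hp] using H.start_deliver j (hU j)
  have hij : |(σ.req i).source - p| ≤ |C i - D j| := by
    rw [hp]
    exact H.collect_deliver_dist i (Finset.mem_univ i) j (hU j)
  rcases hs.1.1.lt_or_eq with hts | hts
  · exact wait_bound hΘ hρ₁ (start_le_of_lt hc hΘ hΘ' hs hts) opt_nonneg (hD j) hY' hui (hC0 i)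
      (h.abs_end_le hc) hpj hij
  · -- `e` is the request of the previous schedule that the optimal schedule delivers last
    obtain ⟨m, hm, e, he, -, hX⟩ := H.exists_minLength_le (Finset.subset_univ _) h.nonempty
      (p := p₀) h.released
    have hm' := abs_sub p₀ (σ.req m).source
    have hvj : v ≤ D j :=
      (h.le_release j hj).trans ((H.release_le j (Finset.mem_univ j)).trans (hCD j))
    have := no_wait_bound hΘ hΘ' hρ₂ ((hCD i).trans (hD i)) (hD j) (hD e) h.nonneg h.le hui h.abs_le
      (h.length_le hc) (by linarith [hC0 m, h.length]) (hXe e he) hY' hvj hpj hij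
      (H.collect_deliver_dist i (Finset.mem_univ i) e (hU e))
    linarith

theorem next (hc : 1 ≤ c) (hΘ : 1 < Θ) (h : IsLastSchedule c Θ σ A p t v u p₀ R) {q : ℝ}
    (hs : IsLeast {s' : ℝ | t ≤ s' ∧ (releasedUntil σ s' \ A).Nonempty ∧
        minLength c σ s' 0 (releasedUntil σ s') / (Θ - 1) ≤ s'} s)
    (hq : Serves c σ (releasedUntil σ s \ A) ∅ p s q
        (s + minLength c σ s p (releasedUntil σ s \ A))) :
    IsLastSchedule c Θ σ (A ∪ releasedUntil σ s) q
      (s + minLength c σ s p (releasedUntil σ s \ A)) u s p (releasedUntil σ s \ A) := by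
  have hus : u ≤ s := h.serves.start_le.trans hs.1.1
  have hA : A ∪ releasedUntil σ s = releasedUntil σ s := by
    rw [h.served]
    exact Finset.union_eq_right.2 (releasedUntil_mono hus)
  refine ⟨h.nonneg.trans h.le, hus, h.abs_end_le hc, fun i hi => ?_, hA, ?_, hs.1.2.1, ?_, hq,
    by ring⟩
  · have h1 := (Finset.mem_sdiff.1 hi).2
    rw [h.served, mem_releasedUntil, not_le] at h1
    exact h1.le
  · rw [hA]
    exact Finset.sdiff_subset
  · have h1 := hs.1.2.2
    rw [div_le_iff₀ (by linarith)] at h1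
    rw [hA]
    linarith

end IsLastSchedule

section UpperBound

variable {c : ℕ∞} {Θ ρ : ℝ} {σ : RequestSeq}

/-- Not only the last schedule, but every schedule of SmarterStart ends before time `ρ * Opt`. -/
theorem SmarterStartFrom.le_mul_opt (hc : 1 ≤ c) (hΘ : 1 < Θ) (hΘ' : Θ ≤ 2) (hρ₁ : fWait Θ ≤ ρ)
    (hρ₂ : fNoWait Θ ≤ ρ) {A : Finset (Fin σ.n)} {p t T v u p₀ : ℝ} {R : Finset (Fin σ.n)}
    (h : SmarterStartFrom c Θ σ A p t T) (hlast : IsLastSchedule c Θ σ A p t v u p₀ R)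
    (ht : t ≤ ρ * opt c σ) : T ≤ ρ * opt c σ := by
  induction h generalizing v u p₀ R with
  | finished p t => exact ht
  | schedule s q start optimal rest ih =>
    exact ih (hlast.next hc hΘ start optimal) (hlast.next_length_le hc hΘ hΘ' hρ₁ hρ₂ start)

theorem IsCompletionTime.le_mul_opt (hc : 1 ≤ c) (hΘ : 1 < Θ) (hΘ' : Θ ≤ 2) (hρ₁ : fWait Θ ≤ ρ)
    (hρ₂ : fNoWait Θ ≤ ρ) {T : ℝ} (h : IsCompletionTime c Θ σ T) : T ≤ ρ * opt c σ := by
  have hpos : 0 < Θ - 1 := by linarith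
  have ho : 0 ≤ opt c σ := opt_nonneg
  unfold IsCompletionTime at h
  -- the start is generalized, for the case distinction on the execution
  generalize hA : (∅ : Finset (Fin σ.n)) = A at h
  generalize hz : (0 : ℝ) = z at h
  cases h with
  | finished =>
    have hρ : 0 ≤ ρ := by
      refine le_trans ?_ hρ₂
      unfold fNoWait
      positivity
    rw [← hz]
    exact mul_nonneg hρ ho
  | schedule s q start optimal rest =>
    subst hz hA
    have hs0 : 0 ≤ s := start.1.1
    have hs : s * (Θ - 1) ≤ opt c σ := by
      rcases hs0.lt_or_eq with h0 | h0
      · exact start_le_of_lt hc hΘ hΘ' start h0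
      · rw [← h0, zero_mul]
        exact ho
    have hY : minLength c σ s 0 (releasedUntil σ s \ ∅) ≤ opt c σ :=
      minLength_le_opt hc fun i hi => mem_releasedUntil.1 (Finset.mem_sdiff.1 hi).1
    refine rest.le_mul_opt hc hΘ hΘ' hρ₁ hρ₂ (v := 0) (u := s) (p₀ := 0)
      (R := releasedUntil σ s \ ∅) ⟨le_rfl, hs0, by simp, fun i _ => (σ.req i).release_nonneg,
        Finset.empty_union _, by simp, start.1.2.1, ?_, optimal, by ring⟩ ?_
    · have h1 := start.1.2.2
      rw [div_le_iff₀ hpos] at h1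
      rw [Finset.empty_union]
      linarith
    · exact wait_bound (u := 0) (p := 0) (a := 0) (τ := 0) (b := 0) hΘ hρ₁ hs ho ho
        (by simpa using hY) le_rfl (by simp) (by simp) (by simp) (by simp)

end UpperBound

/-! ### Point requests -/

/-- Request `i` has to be visited in position `x`, from time `r` on: source and target agree. -/
structure IsPointRequest (σ : RequestSeq) (i : Fin σ.n) (x r : ℝ) : Prop where
  source : (σ.req i).source = x
  target : (σ.req i).target = x
  release : (σ.req i).release = r

section PointRequests

variable {c : ℕ∞} {Θ : ℝ} {σ : RequestSeq} {W A : Finset (Fin σ.n)} {p t q T s x y r r' : ℝ}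
  {i j : Fin σ.n}

theorem IsPointRequest.visit (hi : IsPointRequest σ i x r) (hc : 1 ≤ c) (hiW : i ∉ W) (t' : ℝ)
    (move : t + |x - p| ≤ t') (hr : r ≤ t') (rest : Serves c σ W ∅ x t' q T) :
    Serves c σ (insert i W) ∅ p t q T := by
  refine .collect i t' (Finset.mem_insert_self i W) (by simpa using lt_of_lt_of_le one_pos hc)
    (by rwa [hi.source]) (by rwa [hi.release]) ?_
  refine .deliver i t' (Finset.mem_insert_self i ∅) (by simp [hi.source, hi.target]) ?_
  simpa [Finset.erase_insert hiW, hi.target] using rest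

theorem IsPointRequest.visit_last (hi : IsPointRequest σ i x r) (hc : 1 ≤ c) (t' : ℝ)
    (move : t + |x - p| ≤ t') (hr : r ≤ t') : Serves c σ {i} ∅ p t x t' := by
  have := hi.visit (W := ∅) hc (by simp) t' move hr (.done x t')
  simpa using this

theorem dist_add_dist_le_minLength (hc : 1 ≤ c) (hi : i ∈ W) :
    |(σ.req i).source - p| + |(σ.req i).target - (σ.req i).source| ≤ minLength c σ t p W := by
  refine le_minLength hc fun q T h => ?_
  obtain ⟨C, D, H⟩ := h.exists_timeline_of_empty
  linarith [H.start_collect i hi, H.collect_deliver i hi,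
    H.deliver_le i (Finset.mem_union_left _ hi)]

theorem IsPointRequest.minLength_singleton (hi : IsPointRequest σ i x r) (hc : 1 ≤ c)
    (hr : r ≤ s) : minLength c σ s p {i} = |x - p| := by
  apply le_antisymm
  · have := minLength_le (hi.visit_last (p := p) (t := s) hc _ le_rfl
      (by linarith [abs_nonneg (x - p)]))
    linarith
  · rw [← hi.target]
    exact dist_target_le_minLength hc (Finset.mem_singleton_self i)

theorem Serves.end_eq_of_singleton (h : Serves c σ {i} ∅ p t q T) : q = (σ.req i).target := by
  obtain ⟨C, D, H⟩ := h.exists_timeline_of_empty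
  obtain ⟨e, he, hq, -⟩ := H.exists_last (by simp)
  simp only [Finset.union_empty, Finset.mem_singleton] at he
  rw [hq, he]

/-- A schedule for two requests ends at the target of one of them and visits the target of the
other one before. -/
theorem Serves.pair_cases (h : Serves c σ {i, j} ∅ p t q T) :
    (q = (σ.req j).target ∧
      t + |(σ.req i).target - p| + |(σ.req j).target - (σ.req i).target| ≤ T) ∨
    (q = (σ.req i).target ∧
      t + |(σ.req j).target - p| + |(σ.req j).target - (σ.req i).target| ≤ T) := by
  obtain ⟨C, D, H⟩ := h.exists_timeline_of_empty
  obtain ⟨e, he, hq, hT⟩ := H.exists_last (by simp)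
  have hi : i ∈ ({i, j} ∪ ∅ : Finset (Fin σ.n)) := by simp
  have hj : j ∈ ({i, j} ∪ ∅ : Finset (Fin σ.n)) := by simp
  have hdist := H.deliver_deliver j hj i hi
  simp only [Finset.union_empty, Finset.mem_insert, Finset.mem_singleton] at he
  rcases he with rfl | rfl
  · right
    refine ⟨hq, ?_⟩
    rw [abs_sub_comm (D j), hT, abs_of_nonneg (sub_nonneg.2 (H.deliver_le j hj))] at hdist
    linarith [H.start_deliver j hj]
  · left
    refine ⟨hq, ?_⟩
    rw [hT, abs_of_nonneg (sub_nonneg.2 (H.deliver_le i hi))] at hdist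
    linarith [H.start_deliver i hi]

theorem le_minLength_of_pair (hc : 1 ≤ c) (hi : IsPointRequest σ i x r)
    (hj : IsPointRequest σ j y r') (hiW : i ∈ W) (hjW : j ∈ W) :
    min |x - p| |y - p| + |y - x| ≤ minLength c σ t p W := by
  refine le_trans (le_minLength hc fun q T h => ?_)
    (minLength_mono hc (R := {i, j}) (by simp [Finset.insert_subset_iff, hiW, hjW]))
  have h1 := h.pair_cases
  rw [hi.target, hj.target] at h1
  rcases h1 with ⟨-, h⟩ | ⟨-, h⟩
  · linarith [min_le_left |x - p| |y - p|]
  · linarith [min_le_right |x - p| |y - p|]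

/-! ### Forced steps of SmarterStart -/

theorem SmarterStartFrom.start_le (h : SmarterStartFrom c Θ σ A p t T) : t ≤ T := by
  induction h with
  | finished p t => exact le_rfl
  | schedule s q start optimal rest ih =>
    exact (le_add_of_le_of_nonneg start.1.1 minLength_nonneg).trans ih

theorem SmarterStartFrom.exists_schedule (h : SmarterStartFrom c Θ σ A p t T)
    (hA : A ≠ Finset.univ) :
    ∃ s q, IsLeast {s' : ℝ | t ≤ s' ∧ (releasedUntil σ s' \ A).Nonempty ∧
        minLength c σ s' 0 (releasedUntil σ s') / (Θ - 1) ≤ s'} s ∧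
      Serves c σ (releasedUntil σ s \ A) ∅ p s q
        (s + minLength c σ s p (releasedUntil σ s \ A)) ∧
      SmarterStartFrom c Θ σ (A ∪ releasedUntil σ s) q
        (s + minLength c σ s p (releasedUntil σ s \ A)) T := by
  cases h with
  | finished => exact absurd rfl hA
  | schedule s q start optimal rest => exact ⟨s, q, start, optimal, rest⟩

theorem SmarterStartFrom.exists_schedule_of_isLeast (h : SmarterStartFrom c Θ σ A p t T)
    (hs : IsLeast {s' : ℝ | t ≤ s' ∧ (releasedUntil σ s' \ A).Nonempty ∧
        minLength c σ s' 0 (releasedUntil σ s') / (Θ - 1) ≤ s'} s) :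
    ∃ q, Serves c σ (releasedUntil σ s \ A) ∅ p s q
        (s + minLength c σ s p (releasedUntil σ s \ A)) ∧
      SmarterStartFrom c Θ σ (A ∪ releasedUntil σ s) q
        (s + minLength c σ s p (releasedUntil σ s \ A)) T := by
  have hA : A ≠ Finset.univ := by
    rintro rfl
    obtain ⟨i, hi⟩ := hs.1.2.1
    simp at hi
  obtain ⟨s', q, hs', h1, h2⟩ := h.exists_schedule hA
  obtain rfl := hs'.unique hs
  exact ⟨q, h1, h2⟩

theorem SmarterStartFrom.serve_singleton (hc : 1 ≤ c) (h : SmarterStartFrom c Θ σ A p t T)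
    (hs : IsLeast {s' : ℝ | t ≤ s' ∧ (releasedUntil σ s' \ A).Nonempty ∧
        minLength c σ s' 0 (releasedUntil σ s') / (Θ - 1) ≤ s'} s)
    (hi : IsPointRequest σ i x r) (hR : releasedUntil σ s \ A = {i}) :
    SmarterStartFrom c Θ σ (A ∪ releasedUntil σ s) x (s + |x - p|) T := by
  obtain ⟨q, h1, h2⟩ := h.exists_schedule_of_isLeast hs
  have hr : r ≤ s := by
    have : i ∈ releasedUntil σ s \ A := hR ▸ Finset.mem_singleton_self i
    rw [Finset.mem_sdiff, mem_releasedUntil, hi.release] at this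
    exact this.1
  rw [hR, hi.minLength_singleton hc hr] at h1 h2
  rwa [h1.end_eq_of_singleton, hi.target] at h2

/-- An optimal schedule for two point requests visits the nearer one first. -/
theorem SmarterStartFrom.serve_pair (hc : 1 ≤ c) (h : SmarterStartFrom c Θ σ A p t T)
    (hs : IsLeast {s' : ℝ | t ≤ s' ∧ (releasedUntil σ s' \ A).Nonempty ∧
        minLength c σ s' 0 (releasedUntil σ s') / (Θ - 1) ≤ s'} s)
    (hi : IsPointRequest σ i x r) (hj : IsPointRequest σ j y r') (hij : i ≠ j)
    (hR : releasedUntil σ s \ A = {i, j}) (hlt : |x - p| < |y - p|) :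
    SmarterStartFrom c Θ σ (A ∪ releasedUntil σ s) y (s + (|x - p| + |y - x|)) T := by
  obtain ⟨q, h1, h2⟩ := h.exists_schedule_of_isLeast hs
  have hr : r ≤ s := by
    have : i ∈ releasedUntil σ s \ A := hR ▸ Finset.mem_insert_self i {j}
    rw [Finset.mem_sdiff, mem_releasedUntil, hi.release] at this
    exact this.1
  have hr' : r' ≤ s := by
    have : j ∈ releasedUntil σ s \ A := by simp [hR]
    rw [Finset.mem_sdiff, mem_releasedUntil, hj.release] at this
    exact this.1
  have hle : minLength c σ s p {i, j} ≤ |x - p| + |y - x| := by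
    have h3 := hi.visit (W := {j}) (t := s) (p := p) hc (by simpa using hij) (s + |x - p|) le_rfl
      (by linarith [abs_nonneg (x - p)]) (hj.visit_last hc (s + |x - p| + |y - x|) le_rfl
        (by linarith [abs_nonneg (x - p), abs_nonneg (y - x)]))
    linarith [minLength_le h3]
  rw [hR] at h1 h2
  have h4 := h1.pair_cases
  rw [hi.target, hj.target] at h4
  rcases h4 with ⟨hq, h4⟩ | ⟨-, h4⟩
  · have heq : minLength c σ s p {i, j} = |x - p| + |y - x| := le_antisymm hle (by linarith)
    rwa [heq, hq] at h2
  · exfalso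
    linarith

theorem SmarterStartFrom.add_dist_le (hc : 1 ≤ c) (h : SmarterStartFrom c Θ σ A p t T)
    (hi : IsPointRequest σ i x r) (hiA : i ∉ A) (hrest : ∀ j, j ∉ A → j = i) :
    t + |x - p| ≤ T := by
  obtain ⟨s, q, hs, -, h2⟩ := h.exists_schedule fun hA => hiA (hA ▸ Finset.mem_univ i)
  obtain ⟨j, hj⟩ := hs.1.2.1
  obtain rfl := hrest j (Finset.mem_sdiff.1 hj).2
  have := dist_target_le_minLength (c := c) (t := s) (p := p) hc hj
  rw [hi.target] at this
  linarith [h2.start_le, hs.1.1]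

/-- If `x ≥ 0` is the only position requested at first, then the first schedule starts at time
`y * x`, where `y = 1 / (Θ - 1)`, unless another request appears by then. -/
theorem IsCompletionTime.first_step (hc : 1 ≤ c) (hy : 0 ≤ y) (hyΘ : (Θ - 1) * y = 1)
    (h : IsCompletionTime c Θ σ T) (hi : IsPointRequest σ i x 0) (hx : 0 ≤ x)
    (hrest : ∀ j, j ≠ i → y * x < (σ.req j).release) :
    SmarterStartFrom c Θ σ {i} x (y * x + x) T := by
  have hΘ : 0 < Θ - 1 := by
    by_contra! h
    nlinarith
  have hyx : 0 ≤ y * x := mul_nonneg hy hx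
  have hrel : releasedUntil σ (y * x) = {i} := by
    ext j
    rw [mem_releasedUntil, Finset.mem_singleton]
    constructor
    · intro hj
      by_contra hne
      exact absurd (hrest j hne) (not_lt.2 hj)
    · rintro rfl
      rw [hi.release]
      exact hyx
  have hs : IsLeast {s' : ℝ | 0 ≤ s' ∧ (releasedUntil σ s' \ ∅).Nonempty ∧
        minLength c σ s' 0 (releasedUntil σ s') / (Θ - 1) ≤ s'} (y * x) := by
    refine ⟨⟨hyx, by simp [hrel], ?_⟩, fun s' hs' => ?_⟩
    · rw [hrel, hi.minLength_singleton hc hyx, div_le_iff₀ hΘ, sub_zero, abs_of_nonneg hx]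
      linear_combination (-x) * hyΘ
    · have hi' : i ∈ releasedUntil σ s' := by
        rw [mem_releasedUntil, hi.release]
        exact hs'.1
      have h1 := dist_target_le_minLength (t := s') (p := 0) hc hi'
      have h2 := hs'.2.2
      rw [div_le_iff₀ hΘ] at h2
      rw [hi.target, sub_zero, abs_of_nonneg hx] at h1
      nlinarith [mul_le_mul_of_nonneg_left (h1.trans h2) hy]
  have := SmarterStartFrom.serve_singleton hc h hs hi (by simp [hrel])
  rwa [hrel, Finset.empty_union, sub_zero, abs_of_nonneg hx] at this

end PointRequests

/-! ### Lower bound sequences -/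

section Instances

variable {c : ℕ∞} {Θ : ℝ} {σ : RequestSeq} {T y z a g w r r₁ r₂ : ℝ}

/-- SmarterStart moves to `1` first. While it is on its way, a transport from `-y` to `1` appears;
SmarterStart starts it only at time `y * (2 * y + 1)`. -/
theorem le_of_transport (hc : 1 ≤ c) (hy : 0 ≤ y) (hyΘ : (Θ - 1) * y = 1)
    {i₀ i₁ : Fin σ.n} (h₀ : IsPointRequest σ i₀ 1 0) (hs₁ : (σ.req i₁).source = -y)
    (ht₁ : (σ.req i₁).target = 1) (hr₁ : y < (σ.req i₁).release)
    (hcov : ∀ i, i = i₀ ∨ i = i₁) (h : IsCompletionTime c Θ σ T) :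
    y * (2 * y + 1) + (2 * y + 2) ≤ T := by
  have hne : i₁ ≠ i₀ := by
    rintro rfl
    linarith [h₀.release]
  have h1 := h.first_step hc hy hyΘ h₀ zero_le_one fun j hj => by
    rcases hcov j with rfl | rfl
    · exact absurd rfl hj
    · linarith
  have hΘ : 0 < Θ - 1 := by
    by_contra! h
    nlinarith
  obtain ⟨s, q, hs, -, h2⟩ := h1.exists_schedule fun hA => hne <| by
    have := Finset.mem_univ i₁
    rwa [← hA, Finset.mem_singleton] at this
  obtain ⟨j, hj⟩ := hs.1.2.1
  have hj' := Finset.mem_sdiff.1 hj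
  obtain rfl : j = i₁ := by
    rcases hcov j with rfl | rfl
    · simp at hj'
    · rfl
  have h3 := dist_add_dist_le_minLength (c := c) (t := s) (p := 0) hc hj'.1
  have h4 := dist_add_dist_le_minLength (c := c) (t := s) (p := 1) hc hj
  have h5 := hs.1.2.2
  rw [div_le_iff₀ hΘ] at h5
  rw [hs₁, ht₁, abs_of_nonpos (by linarith), abs_of_nonneg (by linarith)] at h3 h4
  have h6 : 2 * y + 1 ≤ s * (Θ - 1) := by linarith
  have h7 : s * (Θ - 1) * y = s := by linear_combination s * hyΘ
  nlinarith [mul_le_mul_of_nonneg_right h6 hy, h2.start_le]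

theorem opt_le_of_transport (hc : 1 ≤ c) (hy : 0 ≤ y)
    {i₀ i₁ : Fin σ.n} (h₀ : IsPointRequest σ i₀ 1 0) (hs₁ : (σ.req i₁).source = -y)
    (ht₁ : (σ.req i₁).target = 1) (hr₁ : y < (σ.req i₁).release)
    (hcov : ∀ i, i = i₀ ∨ i = i₁) : opt c σ ≤ (σ.req i₁).release + (y + 1) := by
  have hne : i₁ ≠ i₀ := by
    rintro rfl
    linarith [h₀.release]
  have hU : (Finset.univ : Finset (Fin σ.n)).erase i₁ = {i₀} := by
    ext j
    rcases hcov j with rfl | rfl <;> simp [hne, hne.symm]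
  have : Serves c σ Finset.univ ∅ 0 0 1 ((σ.req i₁).release + (y + 1)) := by
    refine .collect i₁ (σ.req i₁).release (Finset.mem_univ i₁)
      (by simpa using lt_of_lt_of_le one_pos hc) ?_ le_rfl ?_
    · rw [hs₁, sub_zero, abs_neg, abs_of_nonneg hy]
      linarith
    refine .deliver i₁ ((σ.req i₁).release + (y + 1)) (Finset.mem_insert_self i₁ ∅) ?_ ?_
    · rw [hs₁, ht₁, abs_of_nonneg (by linarith)]
      linarith
    · rw [hU, ht₁]
      simpa using h₀.visit_last (p := 1) hc _ (le_of_eq (by simp)) (by linarith)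
  exact opt_le this

/-- While SmarterStart moves to `1`, requests appear in `-y` and in `z`, where `z` is slightly
nearer than `-y` to the position `1`. So SmarterStart ends in `-y`, and then has to visit `a`,
requested just after the start of its second schedule at time `y * (2 * y + z)`. -/
theorem le_of_zigzag (hc : 1 ≤ c) (hy : 0 < y) (hyΘ : (Θ - 1) * y = 1)
    {i₀ i₁ i₂ i₃ : Fin σ.n} (h₀ : IsPointRequest σ i₀ 1 0) (h₁ : IsPointRequest σ i₁ (-y) r)
    (h₂ : IsPointRequest σ i₂ z r) (h₃ : IsPointRequest σ i₃ a r₂)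
    (h₁₂ : i₁ ≠ i₂) (hcov : ∀ i, i = i₀ ∨ i = i₁ ∨ i = i₂ ∨ i = i₃)
    (hr : y < r) (hr' : r ≤ y + 1) (hyz : y ≤ z) (hz₁ : 1 ≤ z) (hz : z < 2 + y)
    (hu : y + 1 ≤ y * (2 * y + z)) (hr₂ : y * (2 * y + z) < r₂)
    (h : IsCompletionTime c Θ σ T) :
    y * (2 * y + z) + (2 * z - 1 + y) + |a + y| ≤ T := by
  have hΘ : 0 < Θ - 1 := by
    by_contra! h
    nlinarith
  have h1 := h.first_step hc hy.le hyΘ h₀ zero_le_one fun j hj => by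
    rcases hcov j with rfl | rfl | rfl | rfl
    · exact absurd rfl hj
    · linarith [h₁.release]
    · linarith [h₂.release]
    · linarith [h₃.release]
  have h01 : i₁ ≠ i₀ := by
    rintro rfl
    linarith [h₀.release, h₁.release]
  have h02 : i₂ ≠ i₀ := by
    rintro rfl
    linarith [h₀.release, h₂.release]
  have h03 : i₃ ≠ i₀ := by
    rintro rfl
    linarith [h₀.release, h₃.release]
  have h13 : i₁ ≠ i₃ := by
    rintro rfl
    linarith [h₁.release, h₃.release]
  have h23 : i₂ ≠ i₃ := by
    rintro rfl
    linarith [h₂.release, h₃.release]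
  set u := y * (2 * y + z) with hu_def
  have huΘ : u * (Θ - 1) = 2 * y + z := by
    rw [hu_def]
    linear_combination (2 * y + z) * hyΘ
  have hrel : releasedUntil σ u = {i₁, i₀, i₂} := by
    ext j
    rw [mem_releasedUntil]
    rcases hcov j with rfl | rfl | rfl | rfl
    · simp [h₀.release]
      linarith
    · simp [h₁.release]
      linarith
    · simp [h₂.release]
      linarith
    · simp [h₃.release, h03, h13.symm, h23.symm, hr₂]
  have hdiff : releasedUntil σ u \ {i₀} = {i₂, i₁} := by
    rw [hrel]
    ext j
    simp only [Finset.mem_sdiff, Finset.mem_insert, Finset.mem_singleton]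
    constructor
    · tauto
    · rintro (rfl | rfl)
      · exact ⟨by tauto, h02⟩
      · exact ⟨by tauto, h01⟩
  have hs : IsLeast {s' : ℝ | y * 1 + 1 ≤ s' ∧ (releasedUntil σ s' \ {i₀}).Nonempty ∧
        minLength c σ s' 0 (releasedUntil σ s') / (Θ - 1) ≤ s'} u := by
    refine ⟨⟨by linarith, by simp [hdiff], ?_⟩, fun s' hs' => ?_⟩
    · rw [div_le_iff₀ hΘ, huΘ, hrel]
      have h5 : Serves c σ {i₁, i₀, i₂} ∅ 0 u z (u + (2 * y + z)) := by
        refine h₁.visit hc (by simp [h01, h₁₂]) (u + y) ?_ (by linarith)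
          (h₀.visit hc (by simp [h02.symm]) (u + y + (y + 1)) ?_ (by linarith)
            (h₂.visit_last hc _ ?_ (by linarith)))
        · rw [sub_zero, abs_neg, abs_of_pos hy]
        · rw [abs_of_nonneg (by linarith)]
          linarith
        · rw [abs_of_nonneg (by linarith)]
          linarith
      linarith [minLength_le h5]
    · have h5 : min |-y - 0| |z - 0| + |z - -y| ≤ minLength c σ s' 0 (releasedUntil σ s') := by
        refine le_minLength_of_pair hc h₁ h₂ ?_ ?_
        · rw [mem_releasedUntil, h₁.release]
          linarith [hs'.1]
        · rw [mem_releasedUntil, h₂.release]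
          linarith [hs'.1]
      have h6 := hs'.2.2
      rw [div_le_iff₀ hΘ] at h6
      rw [sub_zero, sub_zero, abs_neg, abs_of_pos hy, abs_of_nonneg (by linarith), min_eq_left hyz,
        abs_of_nonneg (by linarith)] at h5
      refine le_of_mul_le_mul_right ?_ hΘ
      linarith
  have h2 := h1.serve_pair hc hs h₂ h₁ h₁₂.symm hdiff (by
    rw [abs_of_nonneg (by linarith), abs_of_nonpos (by linarith)]
    linarith)
  have h3 := h2.add_dist_le hc h₃ (by simp [hrel, h03, h13.symm, h23.symm]) (fun j hj => by
    rcases hcov j with rfl | rfl | rfl | rfl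
    · simp at hj
    · simp [hrel] at hj
    · simp [hrel] at hj
    · rfl)
  rw [abs_of_nonneg (by linarith), abs_of_nonpos (by linarith : -y - z ≤ 0), sub_neg_eq_add] at h3
  linarith

theorem opt_le_of_zigzag (hc : 1 ≤ c) (hy : 0 < y)
    {i₀ i₁ i₂ i₃ : Fin σ.n} (h₀ : IsPointRequest σ i₀ 1 0) (h₁ : IsPointRequest σ i₁ (-y) r)
    (h₂ : IsPointRequest σ i₂ z r) (h₃ : IsPointRequest σ i₃ a r₂)
    (h₀₁ : i₀ ≠ i₁) (h₀₂ : i₀ ≠ i₂) (h₀₃ : i₀ ≠ i₃) (h₁₂ : i₁ ≠ i₂) (h₁₃ : i₁ ≠ i₃) (h₂₃ : i₂ ≠ i₃)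
    (hcov : ∀ i, i = i₀ ∨ i = i₁ ∨ i = i₂ ∨ i = i₃)
    (hr : y ≤ r) (hz : 1 ≤ z) (ha : z ≤ a) : opt c σ ≤ max (r + y + a) r₂ := by
  have hU : (Finset.univ : Finset (Fin σ.n)) = {i₁, i₀, i₂, i₃} := by
    ext j
    have := hcov j
    simp only [Finset.mem_univ, Finset.mem_insert, Finset.mem_singleton, true_iff]
    tauto
  have : Serves c σ Finset.univ ∅ 0 0 a (max (r + y + a) r₂) := by
    rw [hU]
    refine h₁.visit hc (by simp [h₀₁.symm, h₁₂, h₁₃]) r ?_ le_rfl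
      (h₀.visit hc (by simp [h₀₂, h₀₃]) (r + y + 1) ?_ (by linarith)
        (h₂.visit hc (by simp [h₂₃]) (r + y + z) ?_ (by linarith)
          (h₃.visit_last hc _ (le_trans ?_ (le_max_left _ _)) (le_max_right _ _))))
    · rw [sub_zero, abs_neg, abs_of_pos hy]
      linarith
    · rw [abs_of_nonneg (by linarith)]
      linarith
    · rw [abs_of_nonneg (by linarith)]
      linarith
    · rw [abs_of_nonneg (by linarith)]
      linarith
  exact opt_le this

/-- SmarterStart moves to `g`. Then `0` and `1` are requested, and `g` is so small that SmarterStart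
returns to `0` and moves to `1`. During this schedule `0` and `w` are requested, where `w` is
slightly smaller than `2`, so that SmarterStart ends in `0`; but then `w` is requested again. -/
theorem le_of_two_returns (hc : 1 ≤ c) (hy : 0 < y) (hyΘ : (Θ - 1) * y = 1)
    {i₀ i₁ i₂ i₃ i₄ i₅ : Fin σ.n} (h₀ : IsPointRequest σ i₀ g 0) (h₁ : IsPointRequest σ i₁ 0 r₁)
    (h₂ : IsPointRequest σ i₂ 1 r₁) (h₃ : IsPointRequest σ i₃ 0 r) (h₄ : IsPointRequest σ i₄ w r)
    (h₅ : IsPointRequest σ i₅ w r₂)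
    (h₁₂ : i₁ ≠ i₂) (h₃₄ : i₃ ≠ i₄)
    (hcov : ∀ i, i = i₀ ∨ i = i₁ ∨ i = i₂ ∨ i = i₃ ∨ i = i₄ ∨ i = i₅)
    (hg : 0 < g) (hg' : 2 * g < 1) (hgy : y * g + g = y) (hr₁ : y * g < r₁) (hr₁' : r₁ ≤ y)
    (hr : y < r) (hr' : r ≤ y + (g + 1)) (hr₂ : y + (g + 1) < r₂) (hw : 1 ≤ w) (hw' : w < 2)
    (hyw : y * w ≤ y + (g + 1)) (h : IsCompletionTime c Θ σ T) :
    y + g + 3 * w ≤ T := by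
  have hΘ : 0 < Θ - 1 := by
    by_contra! h
    nlinarith
  have hyg : 0 < y * g := mul_pos hy hg
  have e₀ := h₀.release
  have e₁ := h₁.release
  have e₂ := h₂.release
  have e₃ := h₃.release
  have e₄ := h₄.release
  have e₅ := h₅.release
  have h1 := h.first_step hc hy.le hyΘ h₀ hg.le fun j hj => by
    rcases hcov j with rfl | rfl | rfl | rfl | rfl | rfl
    · exact absurd rfl hj
    all_goals linarith
  rw [hgy] at h1
  have hne : ∀ {i j : Fin σ.n}, (σ.req i).release < (σ.req j).release → i ≠ j := by
    rintro i j hij rfl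
    exact lt_irrefl _ hij
  have h01 : i₀ ≠ i₁ := hne (by linarith)
  have h02 : i₀ ≠ i₂ := hne (by linarith)
  have h03 : i₀ ≠ i₃ := hne (by linarith)
  have h04 : i₀ ≠ i₄ := hne (by linarith)
  have h05 : i₀ ≠ i₅ := hne (by linarith)
  have h13 : i₁ ≠ i₃ := hne (by linarith)
  have h14 : i₁ ≠ i₄ := hne (by linarith)
  have h15 : i₁ ≠ i₅ := hne (by linarith)
  have h23 : i₂ ≠ i₃ := hne (by linarith)
  have h24 : i₂ ≠ i₄ := hne (by linarith)
  have h25 : i₂ ≠ i₅ := hne (by linarith)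
  have h35 : i₃ ≠ i₅ := hne (by linarith)
  have h45 : i₄ ≠ i₅ := hne (by linarith)
  -- the second schedule
  have hrel : releasedUntil σ y = {i₁, i₀, i₂} := by
    ext j
    rw [mem_releasedUntil]
    rcases hcov j with rfl | rfl | rfl | rfl | rfl | rfl
    · simp [e₀, hy.le]
    · simp [e₁, hr₁']
    · simp [e₂, hr₁']
    · simp [e₃, h03.symm, h13.symm, h23.symm, hr]
    · simp [e₄, h04.symm, h14.symm, h24.symm, hr]
    · simp [e₅, h05.symm, h15.symm, h25.symm]
      linarith
  have hdiff : releasedUntil σ y \ {i₀} = {i₁, i₂} := by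
    rw [hrel]
    ext j
    simp only [Finset.mem_sdiff, Finset.mem_insert, Finset.mem_singleton]
    constructor
    · tauto
    · rintro (rfl | rfl)
      · exact ⟨by tauto, h01.symm⟩
      · exact ⟨by tauto, h02.symm⟩
  have hs : IsLeast {s' : ℝ | y ≤ s' ∧ (releasedUntil σ s' \ {i₀}).Nonempty ∧
        minLength c σ s' 0 (releasedUntil σ s') / (Θ - 1) ≤ s'} y := by
    refine ⟨⟨le_rfl, by simp [hdiff], ?_⟩, fun s' hs' => hs'.1⟩
    rw [div_le_iff₀ hΘ, mul_comm, hyΘ, hrel]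
    have h5 : Serves c σ {i₁, i₀, i₂} ∅ 0 y 1 (y + 1) := by
      refine h₁.visit hc (by simp [h01.symm, h₁₂]) y (by simp) hr₁'
        (h₀.visit hc (by simp [h02]) (y + g) ?_ (by linarith)
          (h₂.visit_last hc _ ?_ (by linarith)))
      · rw [abs_of_nonneg (by linarith)]
        linarith
      · rw [abs_of_nonneg (by linarith)]
        linarith
    linarith [minLength_le h5]
  have h2 := h1.serve_pair hc hs h₁ h₂ h₁₂ hdiff (by
    rw [abs_of_nonpos (by linarith), abs_of_nonneg (by linarith)]
    linarith)
  have hun : {i₀} ∪ releasedUntil σ y = {i₁, i₀, i₂} := by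
    rw [hrel]
    ext j
    simp
  rw [hun, abs_of_nonpos (by linarith), abs_of_nonneg (by linarith),
    show y + (-(0 - g) + (1 - 0)) = y + (g + 1) by ring] at h2
  -- the third schedule
  set u := y + (g + 1) with hu
  have hrel' : releasedUntil σ u = {i₁, i₃, i₀, i₂, i₄} := by
    ext j
    rw [mem_releasedUntil]
    rcases hcov j with rfl | rfl | rfl | rfl | rfl | rfl
    · simp [e₀]
      linarith
    · simp [e₁]
      linarith
    · simp [e₂]
      linarith
    · simp [e₃, hr']
    · simp [e₄, hr']
    · simp [e₅, h05.symm, h15.symm, h25.symm, h35.symm, h45.symm, hr₂]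
  have hdiff' : releasedUntil σ u \ {i₁, i₀, i₂} = {i₄, i₃} := by
    rw [hrel']
    ext j
    simp only [Finset.mem_sdiff, Finset.mem_insert, Finset.mem_singleton]
    constructor
    · tauto
    · rintro (rfl | rfl)
      · exact ⟨by tauto, by simp [h04.symm, h14.symm, h24.symm]⟩
      · exact ⟨by tauto, by simp [h03.symm, h13.symm, h23.symm]⟩
  have hs' : IsLeast {s' : ℝ | u ≤ s' ∧ (releasedUntil σ s' \ {i₁, i₀, i₂}).Nonempty ∧
        minLength c σ s' 0 (releasedUntil σ s') / (Θ - 1) ≤ s'} u := by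
    refine ⟨⟨le_rfl, by simp [hdiff'], ?_⟩, fun s' hs' => hs'.1⟩
    rw [div_le_iff₀ hΘ, hrel']
    have h5 : Serves c σ {i₁, i₃, i₀, i₂, i₄} ∅ 0 u w (u + w) := by
      refine h₁.visit hc (by simp [h01.symm, h₁₂, h13, h14]) u (by simp) (by linarith)
        (h₃.visit hc (by simp [h03.symm, h23.symm, h₃₄]) u (by simp) hr'
          (h₀.visit hc (by simp [h02, h04]) (u + g) ?_ (by linarith)
            (h₂.visit hc (by simp [h24]) (u + 1) ?_ (by linarith)
              (h₄.visit_last hc _ ?_ (by linarith)))))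
      · rw [abs_of_nonneg (by linarith)]
        linarith
      · rw [abs_of_nonneg (by linarith)]
        linarith
      · rw [abs_of_nonneg (by linarith)]
        linarith
    have h6 : y * w * (Θ - 1) ≤ u * (Θ - 1) := mul_le_mul_of_nonneg_right hyw hΘ.le
    have h7 : y * w * (Θ - 1) = w := by linear_combination w * hyΘ
    linarith [minLength_le h5]
  have h3 := h2.serve_pair hc hs' h₄ h₃ h₃₄.symm hdiff' (by
    rw [abs_of_nonneg (by linarith), abs_of_nonpos (by linarith)]
    linarith)
  have h4 := h3.add_dist_le hc h₅
    (by simp [hrel', h05.symm, h15.symm, h25.symm, h35.symm, h45.symm]) (fun j hj => by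
      rcases hcov j with rfl | rfl | rfl | rfl | rfl | rfl
      · simp [hrel'] at hj
      · simp [hrel'] at hj
      · simp [hrel'] at hj
      · simp [hrel'] at hj
      · simp [hrel'] at hj
      · rfl)
  rw [abs_of_nonneg (by linarith), abs_of_nonpos (by linarith), abs_of_nonneg (by linarith)] at h4
  linarith

theorem opt_le_of_two_returns (hc : 1 ≤ c)
    {i₀ i₁ i₂ i₃ i₄ i₅ : Fin σ.n} (h₀ : IsPointRequest σ i₀ g 0) (h₁ : IsPointRequest σ i₁ 0 r₁)
    (h₂ : IsPointRequest σ i₂ 1 r₁) (h₃ : IsPointRequest σ i₃ 0 r) (h₄ : IsPointRequest σ i₄ w r)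
    (h₅ : IsPointRequest σ i₅ w r₂) (hd : [i₁, i₃, i₀, i₂, i₄, i₅].Nodup)
    (hcov : ∀ i, i = i₀ ∨ i = i₁ ∨ i = i₂ ∨ i = i₃ ∨ i = i₄ ∨ i = i₅)
    (hg : 0 ≤ g) (hg' : g ≤ 1) (hr : 0 ≤ r) (hr₁ : r₁ ≤ r) (hw : 1 ≤ w) :
    opt c σ ≤ max (r + w) r₂ := by
  have hU : (Finset.univ : Finset (Fin σ.n)) = {i₁, i₃, i₀, i₂, i₄, i₅} := by
    ext j
    have := hcov j
    simp only [Finset.mem_univ, Finset.mem_insert, Finset.mem_singleton, true_iff]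
    tauto
  simp only [List.nodup_cons, List.mem_cons, List.not_mem_nil, or_false] at hd
  have : Serves c σ Finset.univ ∅ 0 0 w (max (r + w) r₂) := by
    rw [hU]
    refine h₁.visit hc (by simp; tauto) r (by simpa using hr) hr₁
      (h₃.visit hc (by simp; tauto) r (by simp) le_rfl
        (h₀.visit hc (by simp; tauto) (r + g) ?_ (by linarith)
          (h₂.visit hc (by simp; tauto) (r + 1) ?_ (by linarith)
            (h₄.visit hc (by simp; tauto) (r + w) ?_ (by linarith)
              (h₅.visit_last hc _ (le_trans ?_ (le_max_left _ _)) (le_max_right _ _))))))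
    · rw [abs_of_nonneg (by linarith)]
      linarith
    · rw [abs_of_nonneg (by linarith)]
      linarith
    · rw [abs_of_nonneg (by linarith)]
      linarith
    · simp
  exact opt_le this

end Instances

/-! ### Lower bounds for the competitive ratio -/

section CompetitiveRatio

variable {c : ℕ∞} {Θ ρ : ℝ} {A : RequestSeq → ℝ}

theorem le_of_forall_small {α β γ κ δ₀ : ℝ} (hδ₀ : 0 < δ₀)
    (h : ∀ δ, 0 < δ → δ ≤ δ₀ → α - β * δ ≤ γ + κ * δ) : α ≤ γ := by
  have h1 : Filter.Tendsto (fun δ : ℝ => α - β * δ) (nhdsWithin 0 (Set.Ioi 0)) (nhds α) := by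
    have : Continuous fun δ : ℝ => α - β * δ := by fun_prop
    simpa using this.continuousWithinAt (s := Set.Ioi 0) (x := 0) |>.tendsto
  have h2 : Filter.Tendsto (fun δ : ℝ => γ + κ * δ) (nhdsWithin 0 (Set.Ioi 0)) (nhds γ) := by
    have : Continuous fun δ : ℝ => γ + κ * δ := by fun_prop
    simpa using this.continuousWithinAt (s := Set.Ioi 0) (x := 0) |>.tendsto
  refine le_of_tendsto_of_tendsto h1 h2 ?_
  filter_upwards [Ioc_mem_nhdsGT hδ₀] with δ hδ
  exact h δ hδ.1 hδ.2

/-- A sequence with known bounds for the algorithm and for the optimum bounds the ratio. -/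
theorem IsCompetitive.le_mul (hA : IsCompetitive c A ρ) {σ : RequestSeq} {x z : ℝ} (hx : 0 < x)
    (h : x ≤ A σ) (hz : opt c σ ≤ z) : x ≤ ρ * z := by
  have h1 := h.trans (hA σ)
  have hρ : 0 ≤ ρ := by
    by_contra! hρ
    nlinarith [opt_nonneg (c := c) (σ := σ)]
  exact h1.trans (mul_le_mul_of_nonneg_left hz hρ)

/-- The request to visit position `x` from time `r` on. -/
def pointRequest (x r : ℝ) (hr : 0 ≤ r) : Request := ⟨x, x, r, hr⟩

theorem IsCompetitive.fWait_le (hc : 1 ≤ c) (hΘ : 1 < Θ) (hA : IsSmarterStart c Θ A)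
    (h : IsCompetitive c A ρ) : fWait Θ ≤ ρ := by
  have hpos : 0 < Θ - 1 := by linarith
  obtain ⟨y, hy⟩ : ∃ y, y = 1 / (Θ - 1) := ⟨_, rfl⟩
  have hyΘ : (Θ - 1) * y = 1 := by rw [hy]; field_simp
  have hy0 : 0 < y := by rw [hy]; positivity
  have key : y * (2 * y + 1) + (2 * y + 2) ≤ ρ * (2 * y + 1) := by
    refine le_of_forall_small (β := 0) (κ := ρ) zero_lt_one fun δ hδ _ => ?_
    let σ : RequestSeq := ⟨2, ![pointRequest 1 0 le_rfl, ⟨-y, 1, y + δ, by positivity⟩]⟩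
    have hcov : ∀ i : Fin σ.n, i = (0 : Fin 2) ∨ i = (1 : Fin 2) :=
      fun i : Fin 2 => by fin_cases i <;> simp
    have h₀ : IsPointRequest σ (0 : Fin 2) 1 0 := ⟨rfl, rfl, rfl⟩
    have hr : y < (σ.req (1 : Fin 2)).release := lt_add_of_pos_right y hδ
    have h1 := le_of_transport hc hy0.le hyΘ h₀ rfl rfl hr hcov (hA σ)
    have h2 : opt c σ ≤ y + δ + (y + 1) := opt_le_of_transport hc hy0.le h₀ rfl rfl hr hcov
    have h3 := h.le_mul (by positivity) h1 h2
    linarith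
  have e : Θ = 1 + 1 / y := by
    rw [hy]
    field_simp
    ring
  have hf : fWait Θ = (y * (2 * y + 1) + (2 * y + 2)) / (2 * y + 1) := by
    rw [fWait, e, div_eq_div_iff ?_ (by positivity)]
    · field_simp
      ring
    · have : (1 + 1 / y) ^ 2 - 1 = (2 + 1 / y) / y := by ring
      rw [this]
      positivity
  rw [hf, div_le_iff₀ (by positivity)]
  exact key

/-- The sequence with `r = y + δ`, `z = 2 + y - δ` and `r₂ = y * (2 * y + z) + δ`, where `δ` is
small; the last request is at `a ≥ z`. -/
theorem IsCompetitive.zigzag_le {y δ a : ℝ} (hc : 1 ≤ c) (hA : IsSmarterStart c Θ A)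
    (h : IsCompetitive c A ρ) (hyΘ : (Θ - 1) * y = 1) (hy : 3 / 5 ≤ y) (hδ : 0 < δ)
    (hδ' : δ ≤ 1 / 2) (ha : 2 + y - δ ≤ a) :
    y * (3 * y + 2 - δ) + (3 + 3 * y - 2 * δ) + (a + y) ≤
      ρ * max (2 * y + δ + a) (y * (3 * y + 2 - δ) + δ) := by
  have hy0 : 0 < y := by linarith
  have hu : y + 1 ≤ y * (2 * y + (2 + y - δ)) := by nlinarith
  have hu0 : 0 ≤ y * (2 * y + (2 + y - δ)) + δ := by linarith
  let σ : RequestSeq := ⟨4, ![pointRequest 1 0 le_rfl, pointRequest (-y) (y + δ) (by positivity),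
    pointRequest (2 + y - δ) (y + δ) (by positivity),
    pointRequest a (y * (2 * y + (2 + y - δ)) + δ) hu0]⟩
  have hcov : ∀ i : Fin σ.n, i = (0 : Fin 4) ∨ i = (1 : Fin 4) ∨ i = (2 : Fin 4) ∨ i = (3 : Fin 4) :=
    fun i : Fin 4 => by fin_cases i <;> simp
  have h₀ : IsPointRequest σ (0 : Fin 4) 1 0 := ⟨rfl, rfl, rfl⟩
  have h₁ : IsPointRequest σ (1 : Fin 4) (-y) (y + δ) := ⟨rfl, rfl, rfl⟩
  have h₂ : IsPointRequest σ (2 : Fin 4) (2 + y - δ) (y + δ) := ⟨rfl, rfl, rfl⟩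
  have h₃ : IsPointRequest σ (3 : Fin 4) a (y * (2 * y + (2 + y - δ)) + δ) := ⟨rfl, rfl, rfl⟩
  have hne : ∀ i j : Fin 4, i ≠ j → (show Fin σ.n from i) ≠ (show Fin σ.n from j) :=
    fun _ _ h => h
  have h1 := le_of_zigzag hc hy0 hyΘ h₀ h₁ h₂ h₃ (hne 1 2 (by decide)) hcov (by linarith)
    (by linarith) (by linarith) (by linarith) (by linarith) hu (by linarith) (hA σ)
  have h2 := opt_le_of_zigzag hc hy0 h₀ h₁ h₂ h₃ (hne 0 1 (by decide)) (hne 0 2 (by decide))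
    (hne 0 3 (by decide)) (hne 1 2 (by decide)) (hne 1 3 (by decide)) (hne 2 3 (by decide)) hcov
    (by linarith) (by linarith) ha
  rw [abs_of_nonneg (by linarith)] at h1
  have h3 := h.le_mul (by nlinarith) h1 h2
  have e1 : y * (2 * y + (2 + y - δ)) = y * (3 * y + 2 - δ) := by ring
  have e2 : y + δ + y + a = 2 * y + δ + a := by ring
  rw [e1, e2] at h3
  linarith

/-- For `Θ ≤ 2` the optimal server has visited all but the last request when SmarterStart
starts its second schedule at time `y * (2 * y + z)`. The last request is placed, up to `δ`, where the optimal server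
is at that time if it goes on to the right. -/
theorem IsCompetitive.fNoWait_le (hc : 1 ≤ c) (hΘ : 1 < Θ) (hΘ' : Θ ≤ 2)
    (hA : IsSmarterStart c Θ A) (h : IsCompetitive c A ρ) : fNoWait Θ ≤ ρ := by
  have hpos : 0 < Θ - 1 := by linarith
  obtain ⟨y, hy⟩ : ∃ y, y = 1 / (Θ - 1) := ⟨_, rfl⟩
  have hyΘ : (Θ - 1) * y = 1 := by rw [hy]; field_simp
  have hy1 : 1 ≤ y := by
    rw [hy, le_div_iff₀ hpos]
    linarith
  have hy0 : 0 < y := by linarith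
  have key : 2 * (y * (3 * y + 2)) + (2 * y + 3) ≤ ρ * (y * (3 * y + 2)) := by
    refine le_of_forall_small (δ₀ := 1 / 2) (β := 2 * y + 2) (κ := ρ * (1 - y)) (by norm_num)
      fun δ hδ hδ' => ?_
    have h1 := h.zigzag_le (a := y * (3 * y + 2 - δ) - 2 * y) hc hA hyΘ (by linarith) hδ hδ'
      (by nlinarith)
    rw [max_eq_right (by linarith)] at h1
    linarith
  have e : Θ = 1 + 1 / y := by
    rw [hy]
    field_simp
    ring
  have hf : fNoWait Θ = (2 * (y * (3 * y + 2)) + (2 * y + 3)) / (y * (3 * y + 2)) := by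
    rw [fNoWait, e, div_eq_div_iff (by positivity) (by positivity)]
    field_simp
    ring
  rw [hf, div_le_iff₀ (by positivity)]
  exact key

/-- For `2 < Θ ≤ 8 / 3` the last request repeats the position where the optimal schedule ends. -/
theorem IsCompetitive.zigzag_le_of_le_one {y : ℝ} (hc : 1 ≤ c) (hA : IsSmarterStart c Θ A)
    (h : IsCompetitive c A ρ) (hyΘ : (Θ - 1) * y = 1) (hy : 3 / 5 ≤ y) (hy1 : y ≤ 1) :
    y * (3 * y + 2) + (5 * y + 5) ≤ ρ * (3 * y + 2) := by
  refine le_of_forall_small (δ₀ := 1 / 2) (β := y + 3) (κ := 0) (by norm_num) fun δ hδ hδ' => ?_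
  have h1 := h.zigzag_le hc hA hyΘ hy hδ hδ' le_rfl
  rw [max_eq_left (by nlinarith)] at h1
  linarith

theorem IsCompetitive.two_returns_le {y : ℝ} (hc : 1 ≤ c) (hA : IsSmarterStart c Θ A)
    (h : IsCompetitive c A ρ) (hyΘ : (Θ - 1) * y = 1) (hy : 0 < y) (hy1 : y < 1) :
    y + y / (1 + y) + 6 ≤ ρ * (y + 2) := by
  refine le_of_forall_small (δ₀ := 1 / 2) (β := 3) (κ := 0) (by norm_num) fun δ hδ hδ' => ?_
  obtain ⟨g, hg⟩ : ∃ g, g = y / (1 + y) := ⟨_, rfl⟩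
  rw [← hg]
  have hg0 : 0 < g := by rw [hg]; positivity
  have hg' : y * g + g = y := by rw [hg]; field_simp; ring
  have hg2 : 2 * g < 1 := by nlinarith
  have hr₂ : 0 ≤ y + (g + 1) + δ := by positivity
  let σ : RequestSeq := ⟨6, ![pointRequest g 0 le_rfl, pointRequest 0 y hy.le,
    pointRequest 1 y hy.le, pointRequest 0 (y + δ) (by positivity),
    pointRequest (2 - δ) (y + δ) (by positivity), pointRequest (2 - δ) (y + (g + 1) + δ) hr₂]⟩
  have hcov : ∀ i : Fin σ.n, i = (0 : Fin 6) ∨ i = (1 : Fin 6) ∨ i = (2 : Fin 6) ∨ i = (3 : Fin 6) ∨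
      i = (4 : Fin 6) ∨ i = (5 : Fin 6) :=
    fun i : Fin 6 => by fin_cases i <;> simp
  have h₀ : IsPointRequest σ (0 : Fin 6) g 0 := ⟨rfl, rfl, rfl⟩
  have h₁ : IsPointRequest σ (1 : Fin 6) 0 y := ⟨rfl, rfl, rfl⟩
  have h₂ : IsPointRequest σ (2 : Fin 6) 1 y := ⟨rfl, rfl, rfl⟩
  have h₃ : IsPointRequest σ (3 : Fin 6) 0 (y + δ) := ⟨rfl, rfl, rfl⟩
  have h₄ : IsPointRequest σ (4 : Fin 6) (2 - δ) (y + δ) := ⟨rfl, rfl, rfl⟩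
  have h₅ : IsPointRequest σ (5 : Fin 6) (2 - δ) (y + (g + 1) + δ) := ⟨rfl, rfl, rfl⟩
  have hne : ∀ i j : Fin 6, i ≠ j → (show Fin σ.n from i) ≠ (show Fin σ.n from j) :=
    fun _ _ h => h
  have hd : ([1, 3, 0, 2, 4, 5] : List (Fin 6)).Nodup := by decide
  have hyg : 0 < y * g := mul_pos hy hg0
  have h1 := le_of_two_returns hc hy hyΘ h₀ h₁ h₂ h₃ h₄ h₅ (hne 1 2 (by decide))
    (hne 3 4 (by decide)) hcov hg0 hg2 hg' (by linarith) le_rfl (by linarith) (by linarith)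
    (by linarith) (by linarith) (by linarith) (by nlinarith) (hA σ)
  have h2 := opt_le_of_two_returns hc h₀ h₁ h₂ h₃ h₄ h₅ hd hcov hg0.le (by linarith)
    (by linarith) (by linarith) (by linarith)
  rw [max_eq_left (by linarith)] at h2
  have h3 := h.le_mul (by linarith) h1 h2
  rw [show y + δ + (2 - δ) = y + 2 by ring] at h3
  linarith

theorem IsCompetitive.le_of_two_lt (hc : 1 ≤ c) (hΘ : 2 < Θ) (hA : IsSmarterStart c Θ A)
    (h : IsCompetitive c A ρ) : 2.667 ≤ ρ := by
  have hpos : 0 < Θ - 1 := by linarith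
  obtain ⟨y, hy⟩ : ∃ y, y = 1 / (Θ - 1) := ⟨_, rfl⟩
  have hyΘ : (Θ - 1) * y = 1 := by rw [hy]; field_simp
  have hy0 : 0 < y := by rw [hy]; positivity
  have hy1 : y < 1 := by
    rw [hy, div_lt_one hpos]
    linarith
  rcases le_total (3 / 5) y with h5 | h5
  · have h1 := h.zigzag_le_of_le_one hc hA hyΘ h5 hy1.le
    by_contra! hρ
    nlinarith
  · have h1 := h.two_returns_le hc hA hyΘ hy0 hy1
    have hg : y / (1 + y) * (1 + y) = y := by field_simp
    have hg' : 5 / 8 * y ≤ y / (1 + y) := by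
      rw [le_div_iff₀ (by linarith)]
      nlinarith
    by_contra! hρ
    nlinarith

theorem le_competitiveRatio (h : ∀ ρ' : ℝ, IsCompetitive c A ρ' → ρ ≤ ρ') :
    (ρ : EReal) ≤ competitiveRatio c A := by
  refine le_sInf ?_
  rintro x ⟨ρ', hρ', rfl⟩
  exact EReal.coe_le_coe_iff.2 (h ρ' hρ')

end CompetitiveRatio

/-! ### The optimal parameter -/

theorem fWait_lt_fWait {a b : ℝ} (ha : 1 < a) (hab : a < b) (hb : b ≤ 2) : fWait b < fWait a := by
  rw [fWait, fWait, div_lt_div_iff₀ (by nlinarith) (by nlinarith)]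
  have h1 : 0 < 3 * (a + b) - a * b - 1 := by nlinarith
  nlinarith [mul_pos (sub_pos.2 hab) h1]

theorem fNoWait_lt_fNoWait {a b : ℝ} (ha : 1 < a) (hab : a < b) : fNoWait a < fNoWait b := by
  rw [fNoWait, fNoWait, div_lt_div_iff₀ (by linarith) (by linarith)]
  have h1 : 0 < 6 * a * b + 3 * (a + b) - 6 := by nlinarith
  nlinarith [mul_pos (sub_pos.2 hab) h1]

theorem fWait_eq_fNoWait_iff {x : ℝ} (hx : 1 < x) :
    fWait x = fNoWait x ↔ 3 * x ^ 4 - 4 * x ^ 3 - x - 4 = 0 := by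
  rw [fWait, fNoWait, div_eq_div_iff (by nlinarith) (by linarith)]
  constructor <;> intro h <;> linear_combination -h

theorem exists_isGreatest_fWait_eq_fNoWait :
    ∃ b : ℝ, IsGreatest {Θ : ℝ | fWait Θ = fNoWait Θ} b ∧ 1.71249 ≤ b ∧ b ≤ 1.7125 := by
  obtain ⟨b, ⟨hb1, hb2⟩, hb⟩ := intermediate_value_Icc (a := (1.71249 : ℝ)) (b := 1.7125)
    (by norm_num) (f := fun x => 3 * x ^ 4 - 4 * x ^ 3 - x - 4) (by fun_prop)
    (show (0 : ℝ) ∈ Set.Icc _ _ by constructor <;> norm_num)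
  simp only at hb
  refine ⟨b, ⟨(fWait_eq_fNoWait_iff (by linarith)).2 hb, fun x hx => ?_⟩, hb1, hb2⟩
  by_contra! hlt
  have h1 := (fWait_eq_fNoWait_iff (by linarith)).1 hx
  have hx1 : 3 / 2 < x := by linarith
  have hb3 : 3 / 2 < b := by linarith
  have hb0 : 0 < b := by linarith
  have hx0 : 0 < x := by linarith
  -- the quotient of the difference of the two polynomial values by `x - b` is positive
  have h2 : 0 < 3 * (x ^ 3 + x ^ 2 * b + x * b ^ 2 + b ^ 3) - 4 * (x ^ 2 + x * b + b ^ 2) - 1 := by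
    have e1 := mul_pos (mul_pos hx0 hx0) (sub_pos.2 hx1)
    have e2 := mul_pos (mul_pos hb0 hb0) (sub_pos.2 hb3)
    have e3 := mul_pos (mul_pos hx0 hb0) (sub_pos.2 hx1)
    have e4 := mul_pos (mul_pos hx0 hb0) (sub_pos.2 hb3)
    have e5 := mul_pos (sub_pos.2 hx1) (sub_pos.2 hb3)
    nlinarith [sq_nonneg x, sq_nonneg b]
  nlinarith [mul_pos (sub_pos.2 hlt) h2]

theorem theorem2 :
    ∃ Θopt ρopt : ℝ,
      IsGreatest {Θ : ℝ | fWait Θ = fNoWait Θ} Θopt ∧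
      ρopt = fWait Θopt ∧
      |Θopt - 1.7125| < 0.00005 ∧
      |ρopt - 2.6662| < 0.00005 ∧
      ∀ c : ℕ∞, 1 ≤ c →
        (∀ Θ : ℝ, 1 < Θ → ∀ σ : RequestSeq, ∃ T : ℝ, IsCompletionTime c Θ σ T) ∧
        (∀ A : RequestSeq → ℝ, IsSmarterStart c Θopt A →
          IsCompetitive c A ρopt ∧ competitiveRatio c A = (ρopt : EReal)) ∧
        (∀ Θ : ℝ, 1 < Θ → Θ ≠ Θopt → ∀ A : RequestSeq → ℝ, IsSmarterStart c Θ A →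
          (ρopt : EReal) < competitiveRatio c A) := by
  obtain ⟨b, hb, hb1, hb2⟩ := exists_isGreatest_fWait_eq_fNoWait
  have heq : fWait b = fNoWait b := hb.1
  have hb0 : 1 < b := by linarith
  have hb3 : b ≤ 2 := by linarith
  have hpos : 0 < 2 * b + 1 := by linarith
  have hρ1 : 2.66616 < fWait b := by
    rw [heq, fNoWait, lt_div_iff₀ hpos]
    nlinarith
  have hρ2 : fWait b < 2.66624 := by
    rw [heq, fNoWait, div_lt_iff₀ hpos]
    nlinarith
  refine ⟨b, fWait b, hb, rfl, abs_lt.2 ⟨by linarith, by linarith⟩,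
    abs_lt.2 ⟨by linarith, by linarith⟩, fun c hc => ⟨fun Θ _ σ => exists_isCompletionTime hc Θ σ,
      fun A hA => ?_, fun Θ hΘ hne A hA => ?_⟩⟩
  · have hcomp : IsCompetitive c A (fWait b) := fun σ =>
      (hA σ).le_mul_opt hc hb0 hb3 le_rfl heq.ge
    exact ⟨hcomp, le_antisymm (sInf_le ⟨_, hcomp, rfl⟩)
      (le_competitiveRatio fun ρ' h => h.fWait_le hc hb0 hA)⟩
  · rcases hne.lt_or_gt with hlt | hgt
    · exact (EReal.coe_lt_coe_iff.2 (fWait_lt_fWait hΘ hlt hb3)).trans_le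
        (le_competitiveRatio fun ρ' h => h.fWait_le hc hΘ hA)
    · rcases le_or_gt Θ 2 with h2 | h2
      · refine (EReal.coe_lt_coe_iff.2 ?_).trans_le
          (le_competitiveRatio fun ρ' h => h.fNoWait_le hc hΘ h2 hA)
        rw [heq]
        exact fNoWait_lt_fNoWait hb0 hgt
      · exact (EReal.coe_lt_coe_iff.2 (by linarith : fWait b < 2.667)).trans_le
          (le_competitiveRatio fun ρ' h => h.le_of_two_lt hc h2 hA)
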